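/- For a sample $x_1,\dots,x_n$ of positive real numbers, let $\mathbb F_n(t)=\frac1n\#\{i: x_i\le t\}$ be its empirical distribution function. The Grenander estimator $\hat f_n$ of a decreasing density on $[0,\infty)$ is the left derivative on $(0,\infty)$ of the least concave majorant of $\mathbb F_n$ on $[0,\infty)$; it is a decreasing step function, and its number of jumps is the number of its points of discontinuity in $(0,\infty)$ (including the final drop to $0$ at $\max_i x_i$). For each $n$, let $X_1,\dots,X_n$ be a sample (independent, identically distributed) from the Uniform$(0,1)$ distribution, where the samples for different $n$ may be defined on different probability spaces, and let $N_{jumps}=N_{jumps}(n)$ be the number of jumps of the Grenander estimator for this sample. Then, as $n\to\infty$, $$\frac{N_{jumps}-\log n}{\sqrt{\log n}}\ \stackrel{\mathcal D}{\longrightarrow}\ N(0,1),$$ where $N(0,1)$ is the standard normal distribution. -/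

import Mathlib

noncomputable section

/-- The empirical distribution function `t ↦ #{i | xᵢ ≤ t} / n` of a sample `x₁, …, xₙ`. -/
def empiricalDistribution {n : ℕ} (x : Fin n → ℝ) (t : ℝ) : ℝ :=
  ((Finset.univ.filter fun i => x i ≤ t).card : ℝ) / n

/-- The least concave majorant of `F` on the set `s`: the pointwise infimum over `s` of all
concave functions on `s` that lie above `F` on `s`. -/
def leastConcaveMajorant (s : Set ℝ) (F : ℝ → ℝ) (t : ℝ) : ℝ :=
  sInf {y | ∃ g : ℝ → ℝ, ConcaveOn ℝ s g ∧ (∀ u ∈ s, F u ≤ g u) ∧ g t = y}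

/-- The Grenander estimator of a decreasing density on `[0, ∞)`, at a point `t > 0`: the left
derivative at `t` of the least concave majorant on `[0, ∞)` of the empirical distribution
function. (The values at `t ≤ 0` are never used.) -/
def grenanderEstimator {n : ℕ} (x : Fin n → ℝ) (t : ℝ) : ℝ :=
  derivWithin (leastConcaveMajorant (Set.Ici 0) (empiricalDistribution x)) (Set.Iio t) t

/-- The number of jumps of the Grenander estimator, i.e. of its points of discontinuity
in `(0, ∞)`. The estimator is a decreasing step function there, so this is a finite number. -/
def grenanderJumps {n : ℕ} (x : Fin n → ℝ) : ℕ :=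
  {t : ℝ | 0 < t ∧ ¬ ContinuousAt (grenanderEstimator x) t}.ncard

end

/-! Reflection in the diagonal turns the least concave majorant of the empirical distribution
function into the greatest convex minorant of the walk of order statistics started at 0, so the
jumps sit at the strict vertices of that minorant (`grenanderJumps_eq_card`). The increments of the
walk are the first `n` uniform spacings: they are exchangeable, and almost surely disjoint sets of
them have different means (`ae_genericVector`).

It therefore suffices to count vertices over all orderings of a generic set of `n` increments, and
this count is distributed as the number of cycles of a uniform permutation
(`sum_orders_numVertices`). The reason is a bijection (`sum_orders_cut`): in an ordering with a
marked increment, take the face over the mark, rotate it to begin with the mark, and move it to the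
front. Cutting out a face loses exactly one vertex (`EdgeSplit.numVertices_eq`), and the move can be
undone because only one rotation of a block lies strictly above its chord (`EdgeSplit.unique`). The
resulting recursion is solved by the rising factorial, whence `E z^N = ∏ (1 + (z - 1) / k)` over `1
≤ k ≤ n` (`integral_pow_grenanderJumps`).

At `z = exp (i s)` with `s = t / √(log n)` this product is within `O(|z - 1|²)` of the Poisson
transform `exp ((z - 1) H_n)`. Since `H_n = log n + O(1)`, centring by `log n` leaves `exp (-t² /
2)` in the limit, and Lévy's continuity theorem concludes. -/

open Finset MeasureTheory ProbabilityTheory Filter Topology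

/-! ### Vertices and faces of convex minorants, in terms of lists of increments. -/

/-- The concatenation point of `a ++ c` is a strict vertex of the greatest convex minorant of the
walk with increments `a ++ c`: every nonempty suffix of `a` has a smaller mean than every nonempty
prefix of `c`. -/
def ListVertex (a c : List ℝ) : Prop :=
  ∀ x y z t : List ℝ, a = x ++ y → c = z ++ t → y ≠ [] → z ≠ [] →
    y.sum * z.length < z.sum * y.length

open Classical in
/-- The number of vertices, apart from the starting point, of the greatest convex minorant of the
walk with increments `l`. -/
noncomputable def numVertices (l : List ℝ) : ℕ :=
  ∑ k ∈ range l.length, if ListVertex (l.take (k + 1)) (l.drop (k + 1)) then 1 else 0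

lemma listVertex_nil_right (a : List ℝ) : ListVertex a [] := by
  intro x y z t _ hc _ hz
  simp_all

lemma ListVertex.of_append_right {a c d : List ℝ} (h : ListVertex a (c ++ d)) :
    ListVertex a c := by
  intro x y z t ha hc hy hz
  exact h x y z (t ++ d) ha (by simp [hc]) hy hz

lemma ListVertex.of_append_left {a b c : List ℝ} (h : ListVertex (a ++ b) c) :
    ListVertex b c := by
  intro x y z t ha hc hy hz
  exact h (a ++ x) y z t (by simp [ha]) hc hy hz

lemma length_pos_real {x : List ℝ} (h : x ≠ []) : (0 : ℝ) < x.length := by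
  exact_mod_cast List.length_pos_iff.2 h

/-- A prefix reaching into `c` is `b ++ d`. A suffix `y` of `a` has smaller mean than `b`, hence
than `y ++ b`'s own mean, which is below that of `d`; so it is below the mean of `b ++ d`. -/
lemma ListVertex.append_right {a b c : List ℝ} (hb : b ≠ []) (h : ListVertex a b)
    (h' : ListVertex (a ++ b) c) : ListVertex a (b ++ c) := by
  intro x y z t ha hc hy hz
  rcases List.append_eq_append_iff.1 hc with ⟨d, rfl, rfl⟩ | ⟨d, rfl, rfl⟩
  · by_cases hd : d = []
    · subst hd
      simpa using h x y b [] ha (by simp) hy hb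
    have h1 := h x y b [] ha (by simp) hy hb
    have h2 := h' (x ++ y) b d t (by simp [ha]) rfl hb hd
    have p1 := length_pos_real hy
    have p2 := length_pos_real hb
    have p3 := length_pos_real hd
    simp only [List.sum_append, List.length_append, Nat.cast_add]
    have h3 : y.sum * d.length * b.length < d.sum * y.length * b.length := by
      nlinarith
    have h4 := lt_of_mul_lt_mul_right h3 p2.le
    linarith
  · exact h x y z d ha rfl hy hz

lemma ListVertex.append_left {a b c : List ℝ} (hb : b ≠ []) (h : ListVertex b c)
    (h' : ListVertex a (b ++ c)) : ListVertex (a ++ b) c := by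
  intro x y z t ha hc hy hz
  rcases List.append_eq_append_iff.1 ha with ⟨d, rfl, rfl⟩ | ⟨d, rfl, rfl⟩
  · exact h d y z t rfl hc hy hz
  · by_cases hd : d = []
    · subst hd
      exact h [] b z t rfl hc hb hz
    have h1 := h [] b z t rfl hc hb hz
    have h2 := h' x d b c rfl rfl hd hb
    have p1 := length_pos_real hz
    have p2 := length_pos_real hb
    have p3 := length_pos_real hd
    simp only [List.sum_append, List.length_append, Nat.cast_add]
    have h3 : d.sum * z.length * b.length < z.sum * d.length * b.length := by
      nlinarith
    have h4 := lt_of_mul_lt_mul_right h3 p2.le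
    linarith

/-- A strict vertex decouples the two sides: whether another point is a vertex is decided within its
own part. -/
lemma numVertices_append {a c : List ℝ} (h : ListVertex a c) :
    numVertices (a ++ c) = numVertices a + numVertices c := by
  classical
  unfold numVertices
  rw [List.length_append, Finset.sum_range_add]
  congr 1
  · refine Finset.sum_congr rfl fun k hk => ?_
    have hk : k + 1 ≤ a.length := Finset.mem_range.1 hk
    rw [List.take_append_of_le_length hk, List.drop_append_of_le_length hk]
    refine if_congr ⟨fun h' => h'.of_append_right, fun h' => ?_⟩ rfl rfl
    by_cases hd : a.drop (k + 1) = []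
    · have : a.take (k + 1) = a := List.take_of_length_le (by simpa using hd)
      rw [hd, this]
      exact h
    · exact h'.append_right hd (by rwa [List.take_append_drop])
  · refine Finset.sum_congr rfl fun k hk => ?_
    rw [add_assoc, List.take_length_add_append, List.drop_length_add_append]
    refine if_congr ⟨fun h' => h'.of_append_left, fun h' => ?_⟩ rfl rfl
    have hk := Finset.mem_range.1 hk
    refine h'.append_left ?_ (by rwa [List.take_append_drop])
    intro h0
    have := congrArg List.length h0
    simp at this
    subst this
    simp at hk

/-- `w` carries a face of the strict greatest convex minorant of the walk with increments
`a ++ w ++ c`: away from the two ends of `w`, the walk lies strictly above the line through the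
two ends. -/
structure EdgeSplit (a w c : List ℝ) : Prop where
  ne_nil : w ≠ []
  left : ∀ x y, a = x ++ y → y ≠ [] → y.sum * w.length < w.sum * y.length
  right : ∀ x y, c = x ++ y → x ≠ [] → w.sum * x.length < x.sum * w.length
  mid : ∀ x y, w = x ++ y → x ≠ [] → y ≠ [] → w.sum * x.length < x.sum * w.length

/-- The mean of `w` separates the suffixes of `a` from the prefixes of `c`, so the two sides still
meet in a vertex once `w` is removed. -/
lemma EdgeSplit.listVertex_outer {a w c : List ℝ} (h : EdgeSplit a w c) : ListVertex a c := by
  intro x y z t ha hc hy hz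
  have h1 := h.left x y ha hy
  have h2 := h.right z t hc hz
  have p1 := length_pos_real hz
  have p2 := length_pos_real h.ne_nil
  have p3 := length_pos_real hy
  refine lt_of_mul_lt_mul_right (a := (w.length : ℝ)) ?_ p2.le
  nlinarith

lemma EdgeSplit.listVertex_left {a w c : List ℝ} (h : EdgeSplit a w c) : ListVertex a w := by
  intro x y z t ha hc hy hz
  have h1 := h.left x y ha hy
  by_cases ht : t = []
  · subst ht
    simp only [List.append_nil] at hc
    rwa [← hc]
  have h2 := h.mid z t hc hz ht
  have p1 := length_pos_real hz
  have p2 := length_pos_real h.ne_nil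
  have p3 := length_pos_real hy
  refine lt_of_mul_lt_mul_right (a := (w.length : ℝ)) ?_ p2.le
  nlinarith

lemma EdgeSplit.listVertex_right {a w c : List ℝ} (h : EdgeSplit a w c) :
    ListVertex (a ++ w) c := by
  refine ListVertex.append_left h.ne_nil ?_ ?_
  · intro x y z t ha hc hy hz
    have h1 := h.right z t hc hz
    have p1 := length_pos_real hz
    have p2 := length_pos_real h.ne_nil
    have p3 := length_pos_real hy
    by_cases hx : x = []
    · subst hx
      rw [List.nil_append] at ha
      rwa [← ha]
    have h2 := h.mid x y ha hx hy
    have e1 : w.sum = x.sum + y.sum := by rw [ha, List.sum_append]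
    have e2 : (w.length : ℝ) = x.length + y.length := by rw [ha]; simp
    have h3 : y.sum * w.length < w.sum * y.length := by
      rw [e1, e2] at h2 ⊢
      linarith
    refine lt_of_mul_lt_mul_right (a := (w.length : ℝ)) ?_ p2.le
    nlinarith
  · intro x y z t ha hc hy hz
    rcases List.append_eq_append_iff.1 hc with ⟨d, rfl, rfl⟩ | ⟨d, hw, rfl⟩
    · by_cases hd : d = []
      · subst hd
        have := h.left x y ha hy
        simpa using this
      have h1 := h.left x y ha hy
      have h2 := h.right d t rfl hd
      have p1 := length_pos_real hd
      have p2 := length_pos_real h.ne_nil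
      have p3 := length_pos_real hy
      refine lt_of_mul_lt_mul_right (a := (w.length : ℝ)) ?_ p2.le
      simp only [List.sum_append, List.length_append, Nat.cast_add]
      nlinarith
    · exact h.listVertex_left x y z d ha hw hy hz

lemma EdgeSplit.numVertices_mid {a w c : List ℝ} (h : EdgeSplit a w c) : numVertices w = 1 := by
  classical
  unfold numVertices
  have hw := List.length_pos_iff.2 h.ne_nil
  obtain ⟨n, hn⟩ : ∃ n, w.length = n + 1 := ⟨w.length - 1, by omega⟩
  rw [hn, Finset.sum_range_succ, Finset.sum_eq_zero, zero_add, if_pos]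
  · rw [← hn, List.drop_length]
    exact listVertex_nil_right _
  · intro k hk
    have hk := Finset.mem_range.1 hk
    rw [if_neg]
    intro hv
    have h1 : w.take (k + 1) ≠ [] := by
      intro h0; have := congrArg List.length h0; simp at this; exact h.ne_nil this
    have h2 : w.drop (k + 1) ≠ [] := by
      intro h0; have := congrArg List.length h0; simp at this; omega
    have h3 := hv [] _ _ [] rfl (by simp) h1 h2
    have h4 := h.mid _ _ (List.take_append_drop (k + 1) w).symm h1 h2
    have e1 : w.sum = (w.take (k + 1)).sum + (w.drop (k + 1)).sum := by
      rw [← List.sum_append, List.take_append_drop]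
    have e2 : (w.length : ℝ) = (w.take (k + 1)).length + (w.drop (k + 1)).length := by
      rw [← Nat.cast_add, ← List.length_append, List.take_append_drop]
    rw [e1, e2] at h4
    linarith

/-- Both ends of the face are vertices, its interior has none, and its two ends merge into one
vertex after the cut. -/
lemma EdgeSplit.numVertices_eq {a w c : List ℝ} (h : EdgeSplit a w c) :
    numVertices (a ++ w ++ c) = numVertices (a ++ c) + 1 := by
  rw [numVertices_append h.listVertex_right, numVertices_append h.listVertex_left,
    numVertices_append h.listVertex_outer, h.numVertices_mid]
  ring

/-- A cycle lemma: if two different rotations of a block both lay above the chord, `m` would begin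
one and end the other, so its mean would be both above and below that of the block. -/
lemma EdgeSplit.unique_aux {u v u' v' a c a' c' : List ℝ} (h : EdgeSplit a (u ++ v) c)
    (h' : EdgeSplit a' (u' ++ v') c') (hv : v ≠ []) (hw : v ++ u = v' ++ u') :
    ¬ ∃ m, m ≠ [] ∧ v' = v ++ m := by
  rintro ⟨m, hm, rfl⟩
  have hu : u = m ++ u' := by simpa using hw
  subst hu
  have h1 := h.mid m (u' ++ v) (by simp) hm (by simp [hv])
  have h2 := h'.mid (u' ++ v) m (by simp) (by simp [hv]) hm
  simp only [List.sum_append, List.length_append, Nat.cast_add] at h1 h2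
  linarith

/-- The rotation of a face and its position are determined by the rearranged list. -/
lemma EdgeSplit.unique {u v u' v' a c a' c' : List ℝ} (h : EdgeSplit a (u ++ v) c)
    (h' : EdgeSplit a' (u' ++ v') c') (hv : v ≠ []) (hv' : v' ≠ [])
    (hl : (u ++ v).length = (u' ++ v').length)
    (he : v ++ u ++ (a ++ c) = v' ++ u' ++ (a' ++ c')) :
    a = a' ∧ u = u' ∧ v = v' ∧ c = c' := by
  obtain ⟨hw, hr⟩ := List.append_inj he (by simp at hl ⊢; omega)
  have hvv : v = v' := by
    rcases List.append_eq_append_iff.1 hw with ⟨m, hm, -⟩ | ⟨m, hm, -⟩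
    · by_contra hne
      refine EdgeSplit.unique_aux h h' hv hw ⟨m, ?_, hm⟩
      rintro rfl; simp at hm; exact hne hm.symm
    · by_contra hne
      refine EdgeSplit.unique_aux h' h hv' hw.symm ⟨m, ?_, hm⟩
      rintro rfl; simp at hm; exact hne hm
  subst hvv
  have huu : u = u' := by simpa using hw
  subst huu
  -- If the cut were at two places, the stretch `m` between them would lie right of the face in one
  -- list and left of it in the other, forcing its mean to be both above and below that of the face.
  have haa : a = a' := by
    rcases List.append_eq_append_iff.1 hr with ⟨m, hm, hc⟩ | ⟨m, hm, hc⟩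
    · by_contra hne
      have hm0 : m ≠ [] := by rintro rfl; simp at hm; exact hne hm.symm
      have h1 := h.right _ _ hc hm0
      have h2 := h'.left _ _ hm hm0
      linarith
    · by_contra hne
      have hm0 : m ≠ [] := by rintro rfl; simp at hm; exact hne hm
      have h1 := h'.right _ _ hc hm0
      have h2 := h.left _ _ hm hm0
      linarith
  subst haa
  exact ⟨rfl, rfl, rfl, by simpa using hr⟩

/-! ### The walk of a list, and existence of a face over each step. -/

/-- The walk with increments `l`. -/
def walk (l : List ℝ) (k : ℕ) : ℝ := (l.take k).sum

lemma walk_sub_walk {l x y z : List ℝ} (h : l = x ++ y ++ z) :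
    walk l (x.length + y.length) - walk l x.length = y.sum := by
  subst h
  unfold walk
  rw [List.append_assoc, List.take_length_add_append, List.take_left]
  simp

/-- No three points of the graph of `S` on `{0, …, n}` are collinear. -/
def NoCollinear (S : ℕ → ℝ) (n : ℕ) : Prop :=
  ∀ i k j, i < k → k < j → j ≤ n → (S k - S i) * ((j : ℝ) - k) ≠ (S j - S k) * ((k : ℝ) - i)

/-- All points of the graph of `S` on `{0, …, n}` other than those at `p` and `q` lie strictly above
the line through those two. -/
structure IsEdge (S : ℕ → ℝ) (n p q : ℕ) : Prop where
  lt : p < q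
  le : q ≤ n
  above : ∀ k ≤ n, k ≠ p → k ≠ q → (S q - S p) * ((k : ℝ) - p) < (S k - S p) * ((q : ℝ) - p)

lemma exists_isEdge {S : ℕ → ℝ} {n m : ℕ} (hS : NoCollinear S n) (hm : m < n) :
    ∃ p q, p ≤ m ∧ m < q ∧ IsEdge S n p q := by
  -- `h` lies strictly between any `p ≤ m` and `q > m`. The quotient minimised is the height at `h`
  -- of the chord from `p` to `q`, so the minimiser spans the face above the step from `m` to `m +
  -- 1`.
  set h : ℝ := m + 1 / 2 with hh
  obtain ⟨⟨p, q⟩, hpq, hmin⟩ := Finset.exists_min_image (range (m + 1) ×ˢ Ioc m n)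
    (fun r : ℕ × ℕ => (S r.1 * (r.2 - h) + S r.2 * (h - r.1)) / ((r.2 : ℝ) - r.1))
    ⟨(0, n), by simp [hm]⟩
  simp only [mem_product, mem_range, mem_Ioc] at hpq
  obtain ⟨hp, hq, hqn⟩ := hpq
  have hp : p ≤ m := by omega
  have hpR : (p : ℝ) ≤ m := by exact_mod_cast hp
  have hqR : (m : ℝ) + 1 ≤ q := by exact_mod_cast hq
  -- A point below the line could replace the end on its own side of `h` and lower the chord there.
  have weak : ∀ k ≤ n, (S q - S p) * ((k : ℝ) - p) ≤ (S k - S p) * ((q : ℝ) - p) := by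
    intro k hk
    rcases le_or_gt k m with hkm | hkm
    · have := hmin (k, q) (by simp; omega)
      have hkR : (k : ℝ) ≤ m := by exact_mod_cast hkm
      simp only at this
      rw [div_le_div_iff₀ (by linarith) (by linarith)] at this
      by_contra hc
      push Not at hc
      nlinarith [mul_lt_mul_of_pos_left hc (show (0 : ℝ) < q - h by linarith)]
    · have := hmin (p, k) (by simp; omega)
      have hkR : (m : ℝ) + 1 ≤ k := by exact_mod_cast hkm
      simp only at this
      rw [div_le_div_iff₀ (by linarith) (by linarith)] at this
      by_contra hc
      push Not at hc
      nlinarith [mul_lt_mul_of_pos_left hc (show (0 : ℝ) < h - p by linarith)]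
  refine ⟨p, q, hp, hq, by omega, hqn, fun k hk hkp hkq => (weak k hk).lt_of_ne fun he => ?_⟩
  rcases lt_or_gt_of_ne hkp with h1 | h1
  · exact hS k p q h1 (by omega) hqn (by linarith)
  · rcases lt_or_gt_of_ne hkq with h2 | h2
    · exact hS p k q h1 h2 hqn (by linarith)
    · exact hS p q k (by omega) h2 hk (by linarith)

/-- Disjoint nonempty subsets of `s` have different means. -/
def GenericMeans (s : Finset ℝ) : Prop :=
  ∀ A ⊆ s, ∀ B ⊆ s, Disjoint A B → A.Nonempty → B.Nonempty →
    (∑ a ∈ A, a) * B.card ≠ (∑ b ∈ B, b) * A.card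

lemma GenericMeans.mono {s t : Finset ℝ} (h : GenericMeans s) (hts : t ⊆ s) : GenericMeans t :=
  fun A hA B hB => h A (hA.trans hts) B (hB.trans hts)

lemma GenericMeans.sum_ne {l x y z t : List ℝ} (hg : GenericMeans l.toFinset) (hl : l.Nodup)
    (h : l = x ++ y ++ (z ++ t)) (hy : y ≠ []) (hz : z ≠ []) :
    y.sum * z.length ≠ z.sum * y.length := by
  subst h
  simp only [List.nodup_append', List.disjoint_append_left, List.disjoint_append_right] at hl
  have hny : y.Nodup := by tauto
  have hnz : z.Nodup := by tauto
  have hyz : y.Disjoint z := by tauto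
  have := hg y.toFinset (by intro; simp; tauto) z.toFinset (by intro; simp; tauto)
    (List.disjoint_toFinset_iff_disjoint.2 hyz) (by simpa using hy) (by simpa using hz)
  rw [List.toFinset_card_of_nodup hny, List.toFinset_card_of_nodup hnz, List.sum_toFinset _ hny,
    List.sum_toFinset _ hnz] at this
  simpa using this

/-- Cutting out the part of a list between two positions. -/
lemma exists_split {l : List ℝ} {i j : ℕ} (hij : i ≤ j) (hj : j ≤ l.length) :
    ∃ x y z, l = x ++ y ++ z ∧ x.length = i ∧ x.length + y.length = j := by
  refine ⟨l.take i, (l.drop i).take (j - i), l.drop j, ?_, ?_, ?_⟩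
  · have : l.drop j = (l.drop i).drop (j - i) := by rw [List.drop_drop]; congr 1; omega
    rw [this, List.append_assoc, List.take_append_drop, List.take_append_drop]
  · simp; omega
  · simp; omega

lemma noCollinear_walk {l : List ℝ} (hg : GenericMeans l.toFinset) (hl : l.Nodup) :
    NoCollinear (walk l) l.length := by
  intro i k j hik hkj hj
  obtain ⟨x, w, t, h, h1, h2⟩ := exists_split (l := l) (hik.trans hkj).le hj
  obtain ⟨_, y, z, rfl, h3, h4⟩ := exists_split (l := w) (i := 0) (j := k - i) (by omega) (by omega)
  obtain rfl := List.length_eq_zero_iff.1 h3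
  simp only [List.nil_append, List.length_append, List.length_nil] at h h2 h4
  have e1 := walk_sub_walk (l := l) (x := x) (y := y) (z := z ++ t) (by simp [h])
  have e2 := walk_sub_walk (l := l) (x := x ++ y) (y := z) (z := t) (by simp [h])
  rw [List.length_append] at e2
  have a1 : x.length + y.length = k := by omega
  have a2 : x.length + y.length + z.length = j := by omega
  rw [a2, a1] at e2
  rw [a1, h1] at e1
  rw [e1, e2]
  have b1 : (j : ℝ) - k = z.length := by rw [← a2, ← a1]; push_cast; ring
  have b2 : (k : ℝ) - i = y.length := by rw [← a1, ← h1]; push_cast; ring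
  rw [b1, b2]
  refine hg.sum_ne hl (x := x) (t := t) (by simp [h]) ?_ ?_
  · rintro rfl; simp at *; omega
  · rintro rfl; simp at *; omega

lemma IsEdge.edgeSplit {a w c : List ℝ}
    (h : IsEdge (walk (a ++ w ++ c)) (a ++ w ++ c).length a.length (a.length + w.length)) :
    EdgeSplit a w c := by
  have e0 := walk_sub_walk (l := a ++ w ++ c) rfl
  have hw : w ≠ [] := by rintro rfl; have := h.lt; simp at this
  have hwl := List.length_pos_iff.2 hw
  refine ⟨hw, ?_, ?_, ?_⟩
  · rintro x y rfl hy
    have hyl := List.length_pos_iff.2 hy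
    have h1 := h.above x.length (by simp) (by simp; omega) (by simp; omega)
    have e1 := walk_sub_walk (l := x ++ y ++ w ++ c) (x := x) (y := y) (z := w ++ c) (by simp)
    rw [← List.length_append] at e1
    rw [e0] at h1
    push_cast [List.length_append] at h1
    simp only [List.length_append] at h1 e1
    nlinarith
  · rintro x y rfl hx
    have hxl := List.length_pos_iff.2 hx
    have h1 := h.above (a.length + w.length + x.length) (by simp; omega) (by simp; omega)
      (by simp; omega)
    have e1 := walk_sub_walk (l := a ++ w ++ (x ++ y)) (x := a ++ w) (y := x) (z := y) (by simp)
    rw [e0] at h1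
    push_cast [List.length_append] at h1
    simp only [List.length_append] at h1 e1
    nlinarith
  · rintro x y rfl hx hy
    have hxl := List.length_pos_iff.2 hx
    have hyl := List.length_pos_iff.2 hy
    have h1 := h.above (a.length + x.length) (by simp) (by simp; omega)
      (by simp only [List.length_append]; omega)
    have e1 := walk_sub_walk (l := a ++ (x ++ y) ++ c) (x := a) (y := x) (z := y ++ c) (by simp)
    rw [e0] at h1
    push_cast [List.length_append] at h1 ⊢
    nlinarith

/-- Here `m` indexes an increment, counted from 0; it is the first entry of `v`, which is why `v` is
nonempty while `u` may be empty. -/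
lemma exists_edgeSplit {l : List ℝ} (hg : GenericMeans l.toFinset) (hl : l.Nodup) {m : ℕ}
    (hm : m < l.length) :
    ∃ a u v c, l = a ++ (u ++ v) ++ c ∧ m = a.length + u.length ∧ v ≠ [] ∧
      EdgeSplit a (u ++ v) c := by
  obtain ⟨p, q, hp, hq, he⟩ := exists_isEdge (noCollinear_walk hg hl) hm
  obtain ⟨a, w, c, rfl, rfl, rfl⟩ := exists_split he.lt.le he.le
  refine ⟨a, w.take (m - a.length), w.drop (m - a.length), c, ?_, ?_, ?_, ?_⟩
  · rw [List.take_append_drop]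
  · simp; omega
  · intro h0; have := congrArg List.length h0; simp at this; omega
  · rw [List.take_append_drop]; exact he.edgeSplit

/-! ### Orderings of a generic set, and the rotation bijection. -/

/-- All orderings of a finite set. -/
noncomputable def orders (s : Finset ℝ) : Finset (List ℝ) := s.toList.permutations.toFinset

lemma mem_orders {s : Finset ℝ} {l : List ℝ} : l ∈ orders s ↔ l.Nodup ∧ l.toFinset = s := by
  unfold orders
  rw [List.mem_toFinset, List.mem_permutations]
  constructor
  · intro h
    refine ⟨h.nodup_iff.2 s.nodup_toList, ?_⟩
    rw [List.toFinset_eq_of_perm _ _ h, Finset.toList_toFinset]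
  · rintro ⟨h, rfl⟩
    exact (List.perm_of_nodup_nodup_toFinset_eq h (Finset.nodup_toList _) (by simp))

lemma length_of_mem_orders {s : Finset ℝ} {l : List ℝ} (h : l ∈ orders s) : l.length = s.card := by
  obtain ⟨h1, rfl⟩ := mem_orders.1 h
  exact (List.toFinset_card_of_nodup h1).symm

lemma mem_orders_of_perm {s : Finset ℝ} {l l' : List ℝ} (h : l ∈ orders s) (hp : l'.Perm l) :
    l' ∈ orders s := by
  rw [mem_orders] at h ⊢
  exact ⟨hp.nodup_iff.2 h.1, by rw [List.toFinset_eq_of_perm _ _ hp, h.2]⟩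

/-- The factor `s.card` marks an increment. Exchanging the mark for the length of its face, and the
ordering for the one with the rotated face in front, permutes the pairs; the face accounts for the
factor `z` and the rest of the list for the remaining vertices. -/
lemma sum_orders_cut {s : Finset ℝ} (hg : GenericMeans s) (z : ℂ) :
    (s.card : ℂ) * ∑ l ∈ orders s, z ^ numVertices l =
      ∑ b ∈ range s.card, ∑ l ∈ orders s, z * z ^ numVertices (l.drop (b + 1)) := by
  classical
  set D := range s.card ×ˢ orders s with hD
  have key : ∀ r : ℕ × List ℝ, r ∈ D → ∃ a u v c, r.2 = a ++ (u ++ v) ++ c ∧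
      r.1 = a.length + u.length ∧ v ≠ [] ∧ EdgeSplit a (u ++ v) c := by
    rintro ⟨m, l⟩ h
    obtain ⟨hm, hl⟩ := mem_product.1 h
    have hlen := length_of_mem_orders hl
    obtain ⟨h1, h2⟩ := mem_orders.1 hl
    exact exists_edgeSplit (h2 ▸ hg) h1 (by rw [hlen]; exact mem_range.1 hm)
  choose! a u v c h1 h2 h3 h4 using key
  -- The face length is stored minus one, so that it ranges over `range s.card` as the mark does.
  let T : ℕ × List ℝ → ℕ × List ℝ := fun r =>
    ((u r ++ v r).length - 1, v r ++ u r ++ (a r ++ c r))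
  have hpos : ∀ r ∈ D, 0 < (u r ++ v r).length := fun r hr => by
    have := List.length_pos_iff.2 (h3 r hr)
    simp; omega
  have hmem : ∀ r ∈ D, T r ∈ D := by
    intro r hr
    obtain ⟨hm, hl⟩ := mem_product.1 hr
    have hlen := length_of_mem_orders hl
    rw [h1 r hr] at hlen
    have := hpos r hr
    refine mem_product.2 ⟨?_, ?_⟩
    · simp [T] at hlen this ⊢; omega
    · refine mem_orders_of_perm hl ?_
      rw [h1 r hr]
      have p1 : (v r ++ u r).Perm (u r ++ v r) := List.perm_append_comm
      refine (p1.append_right _).trans ?_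
      rw [← List.append_assoc]
      exact List.perm_append_comm.append_right _
  have hinj : Set.InjOn T D := by
    intro r hr r' hr' he
    have hr := Finset.mem_coe.1 hr
    have hr' := Finset.mem_coe.1 hr'
    have e1 := congrArg Prod.fst he
    have e2 := congrArg Prod.snd he
    simp only [T] at e1 e2
    have i1 := hpos r hr
    have i2 := hpos r' hr'
    obtain ⟨q1, q2, q3, q4⟩ := (h4 r hr).unique (h4 r' hr') (h3 r hr) (h3 r' hr') (by omega) e2
    refine Prod.ext ?_ ?_
    · rw [h2 r hr, h2 r' hr', q1, q2]
    · rw [h1 r hr, h1 r' hr', q1, q2, q3, q4]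
  -- An injective self-map of a finite set is onto, so no inverse of `T` has to be constructed.
  have himg : D.image T = D := Finset.eq_of_subset_of_card_le
    (Finset.image_subset_iff.2 hmem) (Finset.card_image_of_injOn hinj).ge
  calc (s.card : ℂ) * ∑ l ∈ orders s, z ^ numVertices l
      = ∑ r ∈ D, z ^ numVertices r.2 := by
        rw [hD, Finset.sum_product]; simp
    _ = ∑ r ∈ D, z * z ^ numVertices ((T r).2.drop ((T r).1 + 1)) := by
        refine Finset.sum_congr rfl fun r hr => ?_
        have e : (T r).2.drop ((T r).1 + 1) = a r ++ c r := by
          have := hpos r hr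
          have e3 : (u r ++ v r).length - 1 + 1 = (v r ++ u r).length := by
            simp at this ⊢; omega
          simp only [T]
          rw [e3, List.drop_left]
        rw [e, h1 r hr, (h4 r hr).numVertices_eq, pow_succ']
    _ = ∑ r ∈ D, z * z ^ numVertices (r.2.drop (r.1 + 1)) := by
        conv_rhs => rw [← himg, Finset.sum_image hinj]
    _ = _ := by rw [hD, Finset.sum_product]

lemma sum_orders_cons {s : Finset ℝ} (hs : s.Nonempty) (f : List ℝ → ℂ) :
    ∑ l ∈ orders s, f l = ∑ x ∈ s, ∑ l ∈ orders (s.erase x), f (x :: l) := by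
  rw [Finset.sum_sigma']
  symm
  refine Finset.sum_bij (fun r _ => r.1 :: r.2) ?_ ?_ ?_ ?_
  · rintro ⟨x, l⟩ h
    simp only [mem_sigma, mem_orders] at h ⊢
    obtain ⟨hx, hn, hl⟩ := h
    have : x ∉ l := by rw [← List.mem_toFinset, hl]; simp
    exact ⟨List.nodup_cons.2 ⟨this, hn⟩, by rw [List.toFinset_cons, hl, Finset.insert_erase hx]⟩
  · rintro ⟨x, l⟩ _ ⟨x', l'⟩ _ h
    simpa using h
  · intro l hl
    rw [mem_orders] at hl
    obtain ⟨hn, rfl⟩ := hl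
    cases l with
    | nil => simp at hs
    | cons x l =>
      have hx := (List.nodup_cons.1 hn)
      refine ⟨⟨x, l⟩, ?_, rfl⟩
      simp only [mem_sigma, mem_orders]
      refine ⟨by simp, hx.2, ?_⟩
      rw [List.toFinset_cons, Finset.erase_insert (by simpa using hx.1)]
  · intros; rfl

/-- The falling factorial counts the choices of the discarded entries; what remains is an ordering
of a smaller generic set, whose sum depends only on its size. The bound `N` lets the induction
hypothesis of `sum_orders_numVertices` serve as `hR`. -/
lemma sum_orders_drop {R : ℕ → ℂ} {f : List ℝ → ℂ} {N : ℕ}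
    (hR : ∀ s : Finset ℝ, GenericMeans s → s.card < N → ∑ l ∈ orders s, f l = R s.card) :
    ∀ (b : ℕ) (s : Finset ℝ), GenericMeans s → b + 1 ≤ s.card → s.card ≤ N →
      ∑ l ∈ orders s, f (l.drop (b + 1)) =
        (s.card.descFactorial (b + 1) : ℂ) * R (s.card - (b + 1)) := by
  intro b
  induction b with
  | zero =>
    intro s hg hb hN
    rw [sum_orders_cons (Finset.card_pos.1 (by omega))]
    have : ∀ x ∈ s, ∑ l ∈ orders (s.erase x), f ((x :: l).drop (0 + 1)) = R (s.card - 1) := by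
      intro x hx
      have hc := Finset.card_erase_of_mem hx
      rw [← hc, ← hR _ (hg.mono (Finset.erase_subset _ _)) (by omega)]
      simp
    rw [Finset.sum_congr rfl this]
    simp
  | succ b ih =>
    intro s hg hb hN
    rw [sum_orders_cons (Finset.card_pos.1 (by omega))]
    have : ∀ x ∈ s, ∑ l ∈ orders (s.erase x), f ((x :: l).drop (b + 1 + 1)) =
        ((s.card - 1).descFactorial (b + 1) : ℂ) * R (s.card - (b + 1 + 1)) := by
      intro x hx
      have hc := Finset.card_erase_of_mem hx
      have := ih (s.erase x) (hg.mono (Finset.erase_subset _ _)) (by omega) (by omega)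
      rw [hc] at this
      simp only [List.drop_succ_cons]
      rw [this]
      congr 2
      omega
    rw [Finset.sum_congr rfl this]
    obtain ⟨n, hn⟩ : ∃ n, s.card = n + 1 := ⟨s.card - 1, by omega⟩
    rw [Finset.sum_const, hn, Nat.succ_descFactorial_succ]
    simp
    ring

/-- For `n + 1`, the terms with `b > 0` are `n + 1` times the sum for `n`, and the term `b = 0`
supplies the rest of the new factor `z + n`. -/
lemma rising_recursion (z : ℂ) (n : ℕ) :
    (n : ℂ) * ∏ k ∈ range n, (z + k) =
      z * ∑ b ∈ range n, (n.descFactorial (b + 1) : ℂ) * ∏ k ∈ range (n - (b + 1)), (z + k) := by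
  induction n with
  | zero => simp
  | succ n ih =>
    rw [Finset.sum_range_succ']
    have : ∀ b ∈ range n, ((n + 1).descFactorial (b + 1 + 1) : ℂ) *
        ∏ k ∈ range (n + 1 - (b + 1 + 1)), (z + k) = (n + 1) * ((n.descFactorial (b + 1) : ℂ) *
          ∏ k ∈ range (n - (b + 1)), (z + k)) := by
      intro b _
      rw [Nat.succ_descFactorial_succ, Nat.add_sub_add_right]
      push_cast
      ring
    rw [Finset.sum_congr rfl this, ← Finset.mul_sum, mul_add, mul_left_comm, ← ih,
      Finset.prod_range_succ]
    simp
    ring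

/-- Over all orderings of a generic set of increments, the number of vertices of the greatest
convex minorant is distributed as the number of cycles of a random permutation. -/
theorem sum_orders_numVertices {s : Finset ℝ} (hg : GenericMeans s) (z : ℂ) :
    ∑ l ∈ orders s, z ^ numVertices l = ∏ k ∈ range s.card, (z + k) := by
  induction h : s.card using Nat.strong_induction_on generalizing s with
  | _ n ih =>
    rcases Nat.eq_zero_or_pos n with rfl | hn
    · obtain rfl := Finset.card_eq_zero.1 h
      simp [orders, numVertices]
    · have hn0 : (n : ℂ) ≠ 0 := by exact_mod_cast hn.ne'
      apply mul_left_cancel₀ hn0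
      rw [rising_recursion, ← h, sum_orders_cut hg, Finset.mul_sum]
      refine Finset.sum_congr rfl fun b hb => ?_
      have hb := Finset.mem_range.1 hb
      rw [← Finset.mul_sum]
      congr 1
      exact sum_orders_drop (R := fun m => ∏ k ∈ range m, (z + k))
        (f := fun l => z ^ numVertices l) (N := s.card)
        (fun t ht htc => ih t.card (by omega) ht rfl) b s hg (by omega) le_rfl

/-! ### Vertices read off the graph of the walk. -/

/-- The point at `k` of the graph of `S` on `{0, …, n}` is a strict vertex of its greatest convex
minorant. -/
def IsVertexAt (S : ℕ → ℝ) (n k : ℕ) : Prop :=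
  ∀ i j, i < k → k < j → j ≤ n → (S k - S i) * ((j : ℝ) - k) < (S j - S k) * ((k : ℝ) - i)

lemma listVertex_take_drop_iff {l : List ℝ} {k : ℕ} (hk : k ≤ l.length) :
    ListVertex (l.take k) (l.drop k) ↔ IsVertexAt (walk l) l.length k := by
  have main : ∀ x y z t : List ℝ, l = x ++ y ++ (z ++ t) → x.length + y.length = k →
      (((walk l k - walk l x.length) * (((k + z.length : ℕ) : ℝ) - k) <
        (walk l (k + z.length) - walk l k) * ((k : ℝ) - x.length)) ↔
        y.sum * z.length < z.sum * y.length) := by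
    intro x y z t h hxy
    have e1 := walk_sub_walk (l := l) (x := x) (y := y) (z := z ++ t) (by simp [h])
    have e2 := walk_sub_walk (l := l) (x := x ++ y) (y := z) (z := t) (by simp [h])
    rw [List.length_append] at e2
    rw [hxy] at e1 e2
    rw [e1, e2, ← hxy]
    push_cast
    ring_nf
  constructor
  · intro hv i j hik hkj hj
    obtain ⟨x, y, w, h, h1, h2⟩ := exists_split (l := l) hik.le hk
    have hjw : j - k ≤ w.length := by
      have := congrArg List.length h
      simp at this; omega
    have hz : (w.take (j - k)).length = j - k := by simp [hjw]
    have h3 := (main x y (w.take (j - k)) (w.drop (j - k)) (by simp [h]) h2).2 ?_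
    · rw [hz, h1] at h3
      rwa [Nat.add_sub_cancel' hkj.le] at h3
    · refine hv x y _ (w.drop (j - k)) ?_ ?_ ?_ ?_
      · rw [h, ← h2, ← List.length_append, List.take_left]
      · rw [h, ← h2, ← List.length_append, List.drop_left, List.take_append_drop]
      · rintro rfl; simp at h2; omega
      · intro h0; rw [h0] at hz; simp at hz; omega
  · intro hv x y z t h1 h2 hy hz
    have hl : l = x ++ y ++ (z ++ t) := by rw [← h1, ← h2, List.take_append_drop]
    have hxy : x.length + y.length = k := by
      have := congrArg List.length h1
      simp at this; omega
    have hyl := List.length_pos_iff.2 hy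
    have hzl := List.length_pos_iff.2 hz
    refine (main x y z t hl hxy).1 (hv _ _ (by omega) (by omega) ?_)
    rw [hl]; simp; omega

open Classical in
lemma numVertices_eq_card (l : List ℝ) :
    numVertices l = ((Ioc 0 l.length).filter (IsVertexAt (walk l) l.length)).card := by
  unfold numVertices
  rw [Finset.card_filter, Finset.sum_bij (fun k _ => k + 1)]
  · intro k hk; simp at hk ⊢; omega
  · intro a _ b _ h; simpa using h
  · intro k hk
    simp only [mem_Ioc] at hk
    exact ⟨k - 1, by simp; omega, by omega⟩
  · intro k hk
    simp only [mem_range] at hk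
    exact if_congr (listVertex_take_drop_iff (by omega)) rfl rfl

lemma IsEdge.above_le {S : ℕ → ℝ} {n p q : ℕ} (h : IsEdge S n p q) {k : ℕ} (hk : k ≤ n) :
    (S q - S p) * ((k : ℝ) - p) ≤ (S k - S p) * ((q : ℝ) - p) := by
  by_cases h1 : k = p
  · subst h1; simp
  by_cases h2 : k = q
  · subst h2; rfl
  exact (h.above k hk h1 h2).le

/-- Chords ending at `q` are at most as steep as the face, with equality at `i = p`; chords starting
at `q` are strictly steeper. -/
lemma IsEdge.isVertexAt_right {S : ℕ → ℝ} {n p q : ℕ} (h : IsEdge S n p q) :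
    IsVertexAt S n q := by
  intro i j hi hj hjn
  have h1 := h.above_le (hi.le.trans h.le)
  have h2 := h.above j hjn (h.lt.trans hj).ne' hj.ne'
  have c1 : (i : ℝ) < q := by exact_mod_cast hi
  have c2 : (q : ℝ) < j := by exact_mod_cast hj
  have c3 : (p : ℝ) < q := by exact_mod_cast h.lt
  refine lt_of_mul_lt_mul_right (a := (q : ℝ) - p) ?_ (by linarith)
  have h3 : (S q - S i) * ((q : ℝ) - p) ≤ (S q - S p) * (q - i) := by linarith
  have h4 : (S q - S p) * ((j : ℝ) - q) < (S j - S q) * (q - p) := by linarith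
  nlinarith

lemma IsEdge.not_isVertexAt {S : ℕ → ℝ} {n p q k : ℕ} (h : IsEdge S n p q) (hp : p < k)
    (hq : k < q) : ¬ IsVertexAt S n k := by
  intro hv
  have h1 := hv p q hp hq h.le
  have h2 := h.above k (hq.le.trans h.le) hp.ne' hq.ne
  linarith

/-! ### The Grenander estimator of an increasing sample. -/

section Grenander

variable {n : ℕ} {x : Fin n → ℝ} {S : ℕ → ℝ}

/-- The upper bound on `t` is conditional so that `k = n` covers the unbounded last interval. -/
lemma empiricalDistribution_eq (hx : ∀ i, x i = S (i + 1))
    (hS : ∀ i j, i < j → j ≤ n → S i < S j) {k : ℕ} (hk : k ≤ n) {t : ℝ} (h1 : S k ≤ t)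
    (h2 : k < n → t < S (k + 1)) : empiricalDistribution x t = (k : ℝ) / n := by
  unfold empiricalDistribution
  have : (univ.filter fun i : Fin n => x i ≤ t) = univ.filter fun i : Fin n => (i : ℕ) < k := by
    ext i
    simp only [mem_filter, mem_univ, true_and, hx]
    constructor
    · intro h
      by_contra hc
      have hkn : k < n := by omega
      have := h2 hkn
      rcases (show k + 1 ≤ (i : ℕ) + 1 by omega).eq_or_lt with e | e
      · rw [e] at this; linarith
      · have := hS _ _ e (by omega); linarith
    · intro h
      rcases (show (i : ℕ) + 1 ≤ k by omega).eq_or_lt with e | e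
      · rw [e]; exact h1
      · exact (hS _ _ e hk).le.trans h1
  rw [this, Fin.card_filter_val_lt, min_eq_right hk]

lemma exists_index_le (h0 : S 0 = 0) {t : ℝ} (ht : 0 ≤ t) :
    ∃ k ≤ n, S k ≤ t ∧ (k < n → t < S (k + 1)) := by
  classical
  refine ⟨Nat.findGreatest (fun k => S k ≤ t) n, Nat.findGreatest_le n, ?_, fun h => ?_⟩
  · exact Nat.findGreatest_spec (P := fun k => S k ≤ t) (m := 0) (Nat.zero_le _) (by rwa [h0])
  · have := Nat.findGreatest_is_greatest (P := fun k => S k ≤ t) (n := n) (Nat.lt_succ_self _) h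
    simpa using this

lemma exists_index_lt (h0 : S 0 = 0) {t : ℝ} (ht : 0 < t) (htn : t ≤ S n) :
    ∃ m < n, S m < t ∧ t ≤ S (m + 1) := by
  classical
  have hex : ∃ k, t ≤ S k := ⟨n, htn⟩
  have h1 := Nat.find_spec hex
  have h2 : Nat.find hex ≠ 0 := by
    intro h; rw [h, h0] at h1; linarith
  have h3 : Nat.find hex ≤ n := Nat.find_min' hex htn
  refine ⟨Nat.find hex - 1, by omega, ?_, ?_⟩
  · have := Nat.find_min hex (m := Nat.find hex - 1) (by omega)
    simpa using this
  · rwa [Nat.sub_add_cancel (by omega)]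

lemma concaveOn_affine (c d : ℝ) : ConcaveOn ℝ (Set.Ici (0 : ℝ)) fun t => c * t + d := by
  refine ⟨convex_Ici 0, fun u _ v _ a b _ _ hab => le_of_eq ?_⟩
  simp only [smul_eq_mul]
  linear_combination d * hab

lemma leastConcaveMajorant_eq_of_isLeast {F : ℝ → ℝ} {t c d : ℝ}
    (hF : ∀ u, 0 ≤ u → F u ≤ c * u + d)
    (hlow : ∀ g : ℝ → ℝ, ConcaveOn ℝ (Set.Ici 0) g → (∀ u ∈ Set.Ici (0 : ℝ), F u ≤ g u) →
      c * t + d ≤ g t) :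
    leastConcaveMajorant (Set.Ici 0) F t = c * t + d := by
  refine IsLeast.csInf_eq ⟨⟨_, concaveOn_affine c d, fun u hu => hF u hu, rfl⟩, ?_⟩
  rintro _ ⟨g, hg, hFg, rfl⟩
  exact hlow g hg hFg

/-- The slope of the chord of the inverse of `S / n` over an edge. -/
noncomputable def edgeSlope (S : ℕ → ℝ) (n p q : ℕ) : ℝ := ((q : ℝ) - p) / (S q - S p) / n

/-- Reflected in the diagonal, a face becomes a line above the empirical distribution function that
touches it at `S p` and `S q`; a concave majorant lies above the chord between these two points. -/
lemma IsEdge.majorant_eq (h0 : S 0 = 0) (hx : ∀ i, x i = S (i + 1))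
    (hS : ∀ i j, i < j → j ≤ n → S i < S j) {p q : ℕ} (h : IsEdge S n p q) {t : ℝ}
    (hp : S p ≤ t) (hq : t ≤ S q) :
    leastConcaveMajorant (Set.Ici 0) (empiricalDistribution x) t =
      edgeSlope S n p q * t + ((p : ℝ) / n - edgeSlope S n p q * S p) := by
  have hn : (0 : ℝ) < n := by exact_mod_cast (Nat.zero_le p).trans_lt (h.lt.trans_le h.le)
  have hpq := hS p q h.lt h.le
  have hpq' : (p : ℝ) < q := by exact_mod_cast h.lt
  have hnonneg : ∀ k ≤ n, 0 ≤ S k := fun k hk => by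
    rcases Nat.eq_zero_or_pos k with rfl | hk0
    · exact h0.ge
    · rw [← h0]; exact (hS 0 k hk0 hk).le
  have hval : ∀ k ≤ n, empiricalDistribution x (S k) = (k : ℝ) / n := fun k hk =>
    empiricalDistribution_eq hx hS hk le_rfl fun hkn => hS _ _ (Nat.lt_succ_self k) hkn
  have hc : 0 < edgeSlope S n p q := by
    unfold edgeSlope
    have : 0 < S q - S p := by linarith
    have : (0 : ℝ) < q - p := by linarith
    positivity
  have hcq : edgeSlope S n p q * (S q - S p) = ((q : ℝ) - p) / n := by
    unfold edgeSlope
    have : S q - S p ≠ 0 := by linarith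
    field_simp
  apply leastConcaveMajorant_eq_of_isLeast
  · intro u hu
    obtain ⟨k, hk, h1, h2⟩ := exists_index_le (n := n) h0 hu
    rw [empiricalDistribution_eq hx hS hk h1 h2]
    have h3 := h.above_le hk
    have h4 : ((k : ℝ) - p) / n ≤ edgeSlope S n p q * (S k - S p) := by
      unfold edgeSlope
      rw [div_mul_eq_mul_div, div_mul_eq_mul_div]
      refine div_le_div_of_nonneg_right ?_ hn.le
      rw [le_div_iff₀ (by linarith)]
      linarith
    -- The line increases and the empirical distribution function is constant from `S k` up to `u`,
    -- so the comparison at `S k` suffices.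
    have h5 := mul_le_mul_of_nonneg_left h1 hc.le
    rw [sub_div] at h4
    linarith
  · intro g hg hF
    have h1 := hF (S p) (hnonneg p (h.lt.le.trans h.le))
    have h2 := hF (S q) (hnonneg q h.le)
    rw [hval p (h.lt.le.trans h.le)] at h1
    rw [hval q h.le] at h2
    have ha : 0 ≤ (S q - t) / (S q - S p) := div_nonneg (by linarith) (by linarith)
    have hb : 0 ≤ (t - S p) / (S q - S p) := div_nonneg (by linarith) (by linarith)
    have hne : S q - S p ≠ 0 := by linarith
    have hab : (S q - t) / (S q - S p) + (t - S p) / (S q - S p) = 1 := by field_simp; ring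
    have h3 := hg.2 (hnonneg p (h.lt.le.trans h.le)) (hnonneg q h.le) ha hb hab
    have e1 : (S q - t) / (S q - S p) * S p + (t - S p) / (S q - S p) * S q = t := by
      field_simp; ring
    simp only [smul_eq_mul, e1] at h3
    refine le_trans (le_of_eq ?_) ((add_le_add (mul_le_mul_of_nonneg_left h1 ha)
      (mul_le_mul_of_nonneg_left h2 hb)).trans h3)
    unfold edgeSlope
    field_simp
    ring

lemma majorant_eq_one (hn : 0 < n) (h0 : S 0 = 0) (hx : ∀ i, x i = S (i + 1))
    (hS : ∀ i j, i < j → j ≤ n → S i < S j) {t : ℝ} (ht : S n ≤ t) :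
    leastConcaveMajorant (Set.Ici 0) (empiricalDistribution x) t = 0 * t + 1 := by
  have hnR : (0 : ℝ) < n := by exact_mod_cast hn
  apply leastConcaveMajorant_eq_of_isLeast
  · intro u hu
    obtain ⟨k, hk, h1, h2⟩ := exists_index_le (n := n) h0 hu
    rw [empiricalDistribution_eq hx hS hk h1 h2, zero_mul, zero_add, div_le_one hnR]
    exact_mod_cast hk
  · intro g hg hF
    have := hF t (h0 ▸ (hS 0 n hn le_rfl).le.trans ht)
    rw [empiricalDistribution_eq hx hS le_rfl ht (by simp), div_self hnR.ne'] at this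
    linarith

lemma leftDeriv_eq_of_affine {G : ℝ → ℝ} {a t c d : ℝ} (hat : a < t)
    (h : ∀ u, a ≤ u → u ≤ t → G u = c * u + d) : derivWithin G (Set.Iio t) t = c := by
  have h1 : HasDerivWithinAt (fun u => c * u + d) c (Set.Iio t) t := by
    simpa using (((hasDerivAt_id t).const_mul c).add_const d).hasDerivWithinAt (s := Set.Iio t)
  refine HasDerivWithinAt.derivWithin ?_ (uniqueDiffWithinAt_Iio t)
  refine h1.congr_of_eventuallyEq ?_ (h t hat.le le_rfl)
  filter_upwards [Ioo_mem_nhdsLT hat] with u hu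
  exact h u hu.1.le hu.2.le

lemma IsEdge.grenanderEstimator_eq (h0 : S 0 = 0) (hx : ∀ i, x i = S (i + 1))
    (hS : ∀ i j, i < j → j ≤ n → S i < S j) {p q : ℕ} (h : IsEdge S n p q) {t : ℝ}
    (hp : S p < t) (hq : t ≤ S q) : grenanderEstimator x t = edgeSlope S n p q :=
  leftDeriv_eq_of_affine hp fun _ h1 h2 => h.majorant_eq h0 hx hS h1 (h2.trans hq)

lemma grenanderEstimator_eq_zero (hn : 0 < n) (h0 : S 0 = 0) (hx : ∀ i, x i = S (i + 1))
    (hS : ∀ i j, i < j → j ≤ n → S i < S j) {t : ℝ} (ht : S n < t) :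
    grenanderEstimator x t = 0 :=
  leftDeriv_eq_of_affine ht fun _ h1 _ => majorant_eq_one hn h0 hx hS h1

lemma continuousAt_of_eq_const {f : ℝ → ℝ} {a b c t : ℝ} (h : ∀ u, a < u → u < b → f u = c)
    (ha : a < t) (hb : t < b) : ContinuousAt f t := by
  refine (continuousAt_const (y := c)).congr ?_
  filter_upwards [Ioo_mem_nhds ha hb] with u hu
  exact (h u hu.1 hu.2).symm

lemma not_continuousAt_of_right {f : ℝ → ℝ} {a b c : ℝ} (h : ∀ u, a < u → u < b → f u = c)
    (hab : a < b) (hne : f a ≠ c) : ¬ ContinuousAt f a := by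
  intro hc
  have h1 : Tendsto f (𝓝[>] a) (𝓝 (f a)) := hc.tendsto.mono_left nhdsWithin_le_nhds
  have h2 : Tendsto f (𝓝[>] a) (𝓝 c) := by
    refine tendsto_const_nhds.congr' ?_
    filter_upwards [Ioo_mem_nhdsGT hab] with u hu
    exact (h u hu.1 hu.2).symm
  exact hne (tendsto_nhds_unique h1 h2)

/-- Reflection inverts slopes, so the increasing slopes of the convex minorant become decreasing
ones. -/
lemma edgeSlope_lt {p k q : ℕ} (hn : 0 < n) (h1 : S p < S k)
    (h2 : S k < S q) (hv : (S k - S p) * ((q : ℝ) - k) < (S q - S k) * ((k : ℝ) - p)) :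
    edgeSlope S n k q < edgeSlope S n p k := by
  unfold edgeSlope
  have hnR : (0 : ℝ) < n := by exact_mod_cast hn
  refine div_lt_div_of_pos_right ?_ hnR
  rw [div_lt_div_iff₀ (by linarith) (by linarith)]
  linarith

open Classical in
/-- The jumps of the Grenander estimator are at the vertices of the greatest convex minorant of
the order statistics. -/
theorem grenanderJumps_eq_card (hn : 0 < n) (h0 : S 0 = 0) (hx : ∀ i, x i = S (i + 1))
    (hS : ∀ i j, i < j → j ≤ n → S i < S j) (hg : NoCollinear S n) :
    grenanderJumps x = ((Ioc 0 n).filter (IsVertexAt S n)).card := by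
  have hle : ∀ i j, i ≤ j → j ≤ n → S i ≤ S j := fun i j hij hj => by
    rcases hij.eq_or_lt with rfl | h
    · rfl
    · exact (hS i j h hj).le
  have hset : {t : ℝ | 0 < t ∧ ¬ ContinuousAt (grenanderEstimator x) t} =
      S '' ((Ioc 0 n).filter (IsVertexAt S n) : Finset ℕ) := by
    ext t
    simp only [Set.mem_ofPred_eq, Set.mem_image, coe_filter, mem_Ioc]
    constructor
    · rintro ⟨ht, hc⟩
      have htn : t ≤ S n := by
        by_contra hlt
        push Not at hlt
        exact hc (continuousAt_of_eq_const (b := t + 1)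
          (fun u hu _ => grenanderEstimator_eq_zero hn h0 hx hS hu) hlt (by linarith))
      -- The estimator is constant on `(S p, S q]` for the face over this step, so a discontinuity
      -- can only be at `S q`.
      obtain ⟨m, hm, h1, h2⟩ := exists_index_lt h0 ht htn
      obtain ⟨p, q, hp, hq, he⟩ := exists_isEdge hg hm
      have hpt := (hle p m hp hm.le).trans_lt h1
      have hqt : t ≤ S q := h2.trans (hle _ _ hq he.le)
      refine ⟨q, ⟨⟨by omega, he.le⟩, he.isVertexAt_right⟩, ?_⟩
      by_contra hne
      exact hc (continuousAt_of_eq_const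
        (fun u h1 h2 => he.grenanderEstimator_eq h0 hx hS h1 h2.le) hpt
        (lt_of_le_of_ne hqt (Ne.symm hne)))
    · rintro ⟨k, ⟨⟨hk0, hkn⟩, hv⟩, rfl⟩
      refine ⟨h0 ▸ hS 0 k hk0 hkn, ?_⟩
      -- The face over the step into `k` must end at `k`, since a vertex is never interior to a
      -- face.
      obtain ⟨p, q, hp, hq, he⟩ := exists_isEdge hg (show k - 1 < n by omega)
      obtain rfl : q = k := by
        by_contra hne
        exact he.not_isVertexAt (by omega) (by omega) hv
      have hpq := hS p q he.lt he.le
      have hval := he.grenanderEstimator_eq h0 hx hS hpq le_rfl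
      -- At the last point the estimator falls from a positive slope to 0; at an earlier vertex it
      -- falls to the slope of the next face.
      rcases hkn.eq_or_lt with rfl | hlt
      · refine not_continuousAt_of_right (b := S q + 1)
          (fun u hu _ => grenanderEstimator_eq_zero hn h0 hx hS hu) (by linarith) ?_
        rw [hval]
        unfold edgeSlope
        have h1 : 0 < S q - S p := by linarith
        have h2 : (0 : ℝ) < (q : ℝ) - p := by
          have : (p : ℝ) < q := by exact_mod_cast he.lt
          linarith
        have h3 : (0 : ℝ) < q := by exact_mod_cast hn
        positivity
      · obtain ⟨p', q', hp', hq', he'⟩ := exists_isEdge hg hlt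
        obtain rfl : p' = q := by
          by_contra hne
          exact he'.not_isVertexAt (by omega) hq' hv
        have hpq' := hS p' q' he'.lt he'.le
        refine not_continuousAt_of_right
          (fun u h1 h2 => he'.grenanderEstimator_eq h0 hx hS h1 h2.le) hpq' ?_
        rw [hval]
        exact (edgeSlope_lt hn hpq hpq' (hv p q' he.lt he'.lt he'.le)).ne'
  unfold grenanderJumps
  rw [hset, Set.InjOn.ncard_image, Set.ncard_coe_finset]
  intro i hi j hj hij
  simp only [coe_filter, mem_Ioc, Set.mem_ofPred_eq] at hi hj
  by_contra hne
  rcases lt_or_gt_of_ne hne with h | h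
  · exact (hS i j h hj.1.2).ne hij
  · exact (hS j i h hi.1.2).ne' hij

end Grenander

/-! ### Generic vectors, and almost sure genericity. -/

/-- Disjoint nonempty sets of coordinates of `y` have different means. -/
def GenericVector {n : ℕ} (y : Fin n → ℝ) : Prop :=
  ∀ A B : Finset (Fin n), Disjoint A B → A.Nonempty → B.Nonempty →
    (∑ i ∈ A, y i) * B.card ≠ (∑ i ∈ B, y i) * A.card

section Generic

variable {n : ℕ} {y : Fin n → ℝ}

lemma GenericVector.injective (h : GenericVector y) : Function.Injective y := by
  intro i j hij
  by_contra hne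
  exact h {i} {j} (by simpa using hne) (by simp) (by simp) (by simpa using hij)

lemma GenericVector.genericMeans (h : GenericVector y) : GenericMeans (univ.image y) := by
  intro A hA B hB hAB hAn hBn
  have key : ∀ C ⊆ univ.image y, (univ.filter fun i => y i ∈ C).image y = C := by
    intro C hC
    ext r
    simp only [mem_image, mem_filter, mem_univ, true_and]
    constructor
    · rintro ⟨i, hi, rfl⟩; exact hi
    · intro hr
      obtain ⟨i, -, rfl⟩ := mem_image.1 (hC hr)
      exact ⟨i, hr, rfl⟩
  have hinj : ∀ s : Set (Fin n), Set.InjOn y s := fun s => h.injective.injOn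
  rw [← key A hA, ← key B hB, Finset.sum_image (hinj _), Finset.sum_image (hinj _),
    Finset.card_image_of_injOn (hinj _), Finset.card_image_of_injOn (hinj _)]
  refine h _ _ ?_ ?_ ?_
  · rw [Finset.disjoint_left]
    intro i hi hi'
    simp only [mem_filter, mem_univ, true_and] at hi hi'
    exact Finset.disjoint_left.1 hAB hi hi'
  · rw [← Finset.image_nonempty (f := y), key A hA]; exact hAn
  · rw [← Finset.image_nonempty (f := y), key B hB]; exact hBn

lemma toFinset_ofFn (y : Fin n → ℝ) : (List.ofFn y).toFinset = univ.image y := by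
  ext r; simp

lemma GenericVector.noCollinear (h : GenericVector y) : NoCollinear (walk (List.ofFn y)) n := by
  have := noCollinear_walk (l := List.ofFn y) (by rw [toFinset_ofFn]; exact h.genericMeans)
    (List.nodup_ofFn.2 h.injective)
  rwa [List.length_ofFn] at this

lemma GenericVector.sum_perm (h : GenericVector y) (z : ℂ) :
    ∑ σ : Equiv.Perm (Fin n), z ^ numVertices (List.ofFn (y ∘ σ)) = ∏ k ∈ range n, (z + k) := by
  have hcard : (univ.image y).card = n := by
    rw [Finset.card_image_of_injective _ h.injective]; simp
  have hinj : Function.Injective fun σ : Equiv.Perm (Fin n) => List.ofFn (y ∘ σ) := by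
    intro σ τ he
    ext i
    exact congrArg _ (h.injective (congrFun (List.ofFn_injective he) i))
  have himg : univ.image (fun σ : Equiv.Perm (Fin n) => List.ofFn (y ∘ σ)) =
      orders (univ.image y) := by
    apply Finset.eq_of_subset_of_card_le
    · intro l hl
      obtain ⟨σ, -, rfl⟩ := mem_image.1 hl
      rw [mem_orders]
      refine ⟨List.nodup_ofFn.2 (h.injective.comp σ.injective), ?_⟩
      rw [toFinset_ofFn, ← Finset.image_image]
      congr 1
      exact Finset.image_univ_of_surjective σ.surjective
    · rw [Finset.card_image_of_injective _ hinj, Finset.card_univ, Fintype.card_perm,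
        Fintype.card_fin]
      unfold orders
      rw [List.toFinset_card_of_nodup (List.nodup_permutations _ (Finset.nodup_toList _)),
        List.length_permutations, Finset.length_toList, hcard]
  have h1 := sum_orders_numVertices h.genericMeans z
  rw [hcard, ← himg, Finset.sum_image fun _ _ _ _ he => hinj he] at h1
  exact h1

/-- Each forbidden equality of means cuts out a proper linear subspace, which is null, and there are
finitely many. -/
lemma ae_genericVector (n : ℕ) : ∀ᵐ y : Fin n → ℝ, GenericVector y := by
  unfold GenericVector
  simp only [ae_all_iff]
  intro A B hAB hA hB
  let f : (Fin n → ℝ) →ₗ[ℝ] ℝ :=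
    (B.card : ℝ) • ∑ i ∈ A, LinearMap.proj i - (A.card : ℝ) • ∑ i ∈ B, LinearMap.proj i
  have hf : ∀ y, f y = (∑ i ∈ A, y i) * B.card - (∑ i ∈ B, y i) * A.card := by
    intro y
    simp [f, LinearMap.sum_apply]
    ring
  have hker : LinearMap.ker f ≠ ⊤ := by
    obtain ⟨a, ha⟩ := hA
    intro htop
    have h1 : f (Pi.single a 1) = 0 := by
      rw [← LinearMap.mem_ker, htop]; trivial
    have ha' : a ∉ B := fun hb => Finset.disjoint_left.1 hAB ha hb
    have := hB.card_pos
    simp [hf, Pi.single_apply, ha, ha'] at h1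
    simp [h1] at this
  have h0 := Measure.addHaar_submodule (volume : Measure (Fin n → ℝ)) (LinearMap.ker f) hker
  refine measure_mono_null ?_ h0
  intro y hy
  simp only [Set.mem_compl_iff, Set.mem_ofPred_eq, not_not] at hy
  exact LinearMap.mem_ker.2 (by rw [hf, hy, sub_self])

end Generic

/-! ### Spacings and order statistics. -/

section PartialSums

/-- The matrix of the partial sum map. -/
def partialSumMatrix (n : ℕ) : Matrix (Fin n) (Fin n) ℝ := fun i j => if j ≤ i then 1 else 0

lemma det_partialSumMatrix (n : ℕ) : (partialSumMatrix n).det = 1 := by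
  rw [Matrix.det_of_isLowerTriangular]
  · simp [partialSumMatrix]
  · intro i j hij
    have hij : i < j := hij
    simp [partialSumMatrix, not_le.2 hij]

/-- The partial sum map `y ↦ (y₀, y₀ + y₁, …)`. -/
noncomputable def partialSums (n : ℕ) : (Fin n → ℝ) ≃ᵐ (Fin n → ℝ) :=
  (Matrix.toLinearEquiv' (partialSumMatrix n)
    (Matrix.invertibleOfIsUnitDet _ (by rw [det_partialSumMatrix]; exact isUnit_one))
    ).toContinuousLinearEquiv.toHomeomorph.toMeasurableEquiv

lemma partialSums_eq (n : ℕ) : ⇑(partialSums n) = Matrix.toLin' (partialSumMatrix n) := rfl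

lemma measurePreserving_partialSums (n : ℕ) :
    MeasurePreserving (partialSums n) volume volume := by
  refine ⟨(partialSums n).measurable, ?_⟩
  rw [partialSums_eq, Real.map_matrix_volume_pi_eq_smul_volume_pi (by simp [det_partialSumMatrix]),
    det_partialSumMatrix]
  simp

lemma walk_ofFn {n : ℕ} (y : Fin n → ℝ) (k : ℕ) :
    walk (List.ofFn y) k = ∑ j with j.val < k, y j := List.sum_take_ofFn y k

lemma partialSums_apply {n : ℕ} (y : Fin n → ℝ) (i : Fin n) :
    partialSums n y i = walk (List.ofFn y) (i + 1) := by
  rw [partialSums_eq, walk_ofFn, Matrix.toLin'_apply, Matrix.mulVec, dotProduct,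
    Finset.sum_filter]
  refine Finset.sum_congr rfl fun j _ => ?_
  have : (j ≤ i) ↔ ((j : ℕ) < i + 1) := by rw [Fin.le_def]; omega
  simp only [partialSumMatrix, this, ite_mul, one_mul, zero_mul]

lemma walk_strictMono {n : ℕ} {y : Fin n → ℝ} (hy : ∀ i, 0 < y i) :
    ∀ i j, i < j → j ≤ n → walk (List.ofFn y) i < walk (List.ofFn y) j := by
  intro i j hij hj
  rw [walk_ofFn, walk_ofFn]
  refine Finset.sum_lt_sum_of_subset (i := ⟨i, by omega⟩) ?_ ?_ ?_ (hy _) fun k _ _ => (hy k).le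
  · intro k hk
    simp only [mem_filter, mem_univ, true_and] at hk ⊢
    omega
  · exact mem_filter.2 ⟨mem_univ _, hij⟩
  · exact fun h => lt_irrefl _ (mem_filter.1 h).2

theorem grenanderJumps_partialSums {n : ℕ} (hn : 0 < n) {y : Fin n → ℝ} (hy : ∀ i, 0 < y i)
    (hg : GenericVector y) : grenanderJumps (partialSums n y) = numVertices (List.ofFn y) := by
  rw [grenanderJumps_eq_card (S := walk (List.ofFn y)) hn (by simp [walk]) (partialSums_apply y)
    (walk_strictMono hy) hg.noCollinear, numVertices_eq_card, List.length_ofFn]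

/-- The open simplex of spacings. -/
def spacings (n : ℕ) : Set (Fin n → ℝ) := {y | (∀ i, 0 < y i) ∧ ∑ i, y i < 1}

/-- The increasing vectors in the open unit cube. -/
def orderedCube (n : ℕ) : Set (Fin n → ℝ) := {x | (∀ i, x i ∈ Set.Ioo (0 : ℝ) 1) ∧ StrictMono x}

lemma measurableSet_spacings (n : ℕ) : MeasurableSet (spacings n) := by
  unfold spacings
  refine MeasurableSet.inter ?_ ?_
  · exact measurableSet_setOfPred.2 (Measurable.forall fun i =>
      measurableSet_setOfPred.1 (measurableSet_lt measurable_const (measurable_pi_apply i)))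
  · exact measurableSet_lt (f := fun y : Fin n → ℝ => ∑ i, y i) (by fun_prop) measurable_const

lemma partialSums_mem_orderedCube {n : ℕ} (hn : 0 < n) (y : Fin n → ℝ) :
    partialSums n y ∈ orderedCube n ↔ y ∈ spacings n := by
  have hlast : walk (List.ofFn y) n = ∑ i, y i := by
    rw [walk_ofFn]; congr 1; ext j; simp
  have h0 : walk (List.ofFn y) 0 = 0 := by simp [walk]
  have hstep : ∀ i : Fin n, walk (List.ofFn y) (i + 1) - walk (List.ofFn y) i = y i := by
    intro i
    have : (univ.filter fun j : Fin n => (j : ℕ) < i + 1) =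
        insert i (univ.filter fun j : Fin n => (j : ℕ) < i) := by
      ext j; simp [Fin.ext_iff]; omega
    rw [walk_ofFn, walk_ofFn, this, Finset.sum_insert (by simp)]
    ring
  constructor
  · rintro ⟨h1, h2⟩
    refine ⟨fun i => ?_, ?_⟩
    · rw [← hstep i]
      have e1 := partialSums_apply y i
      by_cases hi : (i : ℕ) = 0
      · have := (h1 i).1
        rw [e1] at this
        rw [hi] at this ⊢
        rw [h0]; simpa using this
      · have e2 := partialSums_apply y ⟨i - 1, by omega⟩
        have := h2 (a := ⟨i - 1, by omega⟩) (b := i) (by rw [Fin.lt_def]; simp; omega)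
        rw [e1, e2] at this
        simp only [Nat.sub_add_cancel (show 1 ≤ (i : ℕ) by omega)] at this
        linarith
    · have e1 := partialSums_apply y ⟨n - 1, by omega⟩
      have := (h1 ⟨n - 1, by omega⟩).2
      rw [e1] at this
      simp only [Nat.sub_add_cancel (show 1 ≤ n by omega)] at this
      rwa [hlast] at this
  · rintro ⟨h1, h2⟩
    have hm := walk_strictMono h1
    refine ⟨fun i => ?_, fun i j hij => ?_⟩
    · rw [partialSums_apply]
      refine ⟨h0 ▸ hm 0 _ (by omega) (by omega), ?_⟩
      rcases (show (i : ℕ) + 1 ≤ n by omega).eq_or_lt with e | e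
      · rw [e, hlast]; exact h2
      · exact (hm _ _ e le_rfl).trans (hlast ▸ h2)
    · rw [partialSums_apply, partialSums_apply]
      have : (i : ℕ) < j := hij
      exact hm _ _ (by omega) (by omega)

end PartialSums

/-! ### Permutation invariance and measurability. -/

lemma grenanderJumps_comp_perm {n : ℕ} (x : Fin n → ℝ) (σ : Equiv.Perm (Fin n)) :
    grenanderJumps (x ∘ σ) = grenanderJumps x := by
  have : empiricalDistribution (x ∘ σ) = empiricalDistribution x := by
    funext t
    unfold empiricalDistribution
    congr 2
    refine Finset.card_equiv σ fun i => by simp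
  unfold grenanderJumps grenanderEstimator
  rw [this]

lemma measurable_numVertices_ofFn (n : ℕ) :
    Measurable fun y : Fin n → ℝ => numVertices (List.ofFn y) := by
  classical
  simp only [numVertices_eq_card, Finset.card_filter, List.length_ofFn]
  refine Finset.measurable_sum _ fun k _ => Measurable.ite ?_ measurable_const measurable_const
  have hw : ∀ i, Measurable fun y : Fin n → ℝ => walk (List.ofFn y) i := by
    intro i
    simp only [walk_ofFn]
    fun_prop
  unfold IsVertexAt
  refine measurableSet_setOfPred.2 (Measurable.forall fun i => Measurable.forall fun j =>
    Measurable.forall fun _ => Measurable.forall fun _ => Measurable.forall fun _ => ?_)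
  have h1 := hw k
  have h2 := hw i
  have h3 := hw j
  exact measurableSet_setOfPred.1 (measurableSet_lt (by fun_prop) (by fun_prop))

lemma measurePreserving_comp_perm {n : ℕ} (m : Measure ℝ) [SigmaFinite m]
    (σ : Equiv.Perm (Fin n)) :
    MeasurePreserving (fun x : Fin n → ℝ => x ∘ σ) (Measure.pi fun _ => m)
      (Measure.pi fun _ => m) := by
  have := measurePreserving_piCongrLeft (α := fun _ : Fin n => ℝ) (fun _ => m) σ.symm
  convert this using 1
  funext x i
  obtain ⟨j, rfl⟩ := σ.symm.surjective i
  rw [MeasurableEquiv.coe_piCongrLeft, Equiv.piCongrLeft_apply_apply]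
  simp

/-! ### The generating function of the number of jumps. -/

section Law

variable {n : ℕ}

/-- The uniform distribution on the unit cube. -/
noncomputable def uniformCube (n : ℕ) : Measure (Fin n → ℝ) :=
  Measure.pi fun _ => volume.restrict (Set.Ioo (0 : ℝ) 1)

lemma uniformCube_eq (n : ℕ) :
    uniformCube n = volume.restrict (Set.univ.pi fun _ => Set.Ioo (0 : ℝ) 1) := by
  rw [uniformCube, volume_pi, Measure.restrict_pi_pi]

instance isProbabilityMeasure_uniformCube (n : ℕ) : IsProbabilityMeasure (uniformCube n) := by
  have : IsProbabilityMeasure (volume.restrict (Set.Ioo (0 : ℝ) 1)) := ⟨by simp⟩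
  unfold uniformCube
  infer_instance

/-- The number of vertices of the greatest convex minorant of an increasing sample. -/
noncomputable def orderedVertices (n : ℕ) (x : Fin n → ℝ) : ℕ :=
  numVertices (List.ofFn ((partialSums n).symm x))

lemma measurable_orderedVertices (n : ℕ) : Measurable (orderedVertices n) :=
  (measurable_numVertices_ofFn n).comp (partialSums n).symm.measurable

lemma orderedCube_eq_preimage (hn : 0 < n) :
    orderedCube n = (partialSums n).symm ⁻¹' spacings n := by
  ext x
  rw [Set.mem_preimage, ← partialSums_mem_orderedCube hn, MeasurableEquiv.apply_symm_apply]

lemma measurableSet_orderedCube (hn : 0 < n) : MeasurableSet (orderedCube n) := by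
  rw [orderedCube_eq_preimage hn]
  exact (partialSums n).symm.measurable (measurableSet_spacings n)

lemma ae_grenanderJumps_eq (hn : 0 < n) :
    ∀ᵐ x : Fin n → ℝ, x ∈ orderedCube n → grenanderJumps x = orderedVertices n x := by
  have hmp := (measurePreserving_partialSums n).symm (partialSums n)
  filter_upwards [hmp.quasiMeasurePreserving.ae (ae_genericVector n)] with x hx hmem
  rw [orderedCube_eq_preimage hn] at hmem
  have := grenanderJumps_partialSums hn hmem.1 hx
  rwa [MeasurableEquiv.apply_symm_apply] at this

lemma ae_uniformCube_of_ae {p : (Fin n → ℝ) → Prop} (h : ∀ᵐ x, p x) :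
    ∀ᵐ x ∂uniformCube n, p x := by
  rw [uniformCube_eq]
  exact ae_restrict_of_ae h

lemma measurePreserving_uniformCube (σ : Equiv.Perm (Fin n)) :
    MeasurePreserving (fun x : Fin n → ℝ => x ∘ σ) (uniformCube n) (uniformCube n) :=
  measurePreserving_comp_perm _ σ

/-- A function of the number of jumps is a sum over the possible orderings of the sample. -/
lemma ae_comp_grenanderJumps {E : Type*} [AddCommMonoid E] (hn : 0 < n) (f : ℕ → E) :
    ∀ᵐ x ∂uniformCube n, f (grenanderJumps x) = ∑ σ : Equiv.Perm (Fin n),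
      (orderedCube n).indicator (fun x => f (orderedVertices n x)) (x ∘ σ) := by
  have h1 : ∀ᵐ x ∂uniformCube n, ∀ σ : Equiv.Perm (Fin n), x ∘ σ ∈ orderedCube n →
      grenanderJumps (x ∘ σ) = orderedVertices n (x ∘ σ) :=
    ae_all_iff.2 fun σ => (measurePreserving_uniformCube σ).quasiMeasurePreserving.ae
      (ae_uniformCube_of_ae (ae_grenanderJumps_eq hn))
  have h2 : ∀ᵐ x ∂uniformCube n, ∀ i, x i ∈ Set.Ioo (0 : ℝ) 1 := by
    rw [uniformCube_eq]
    filter_upwards [ae_restrict_mem (MeasurableSet.univ_pi fun _ => measurableSet_Ioo)] with x hx i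
    exact hx i (Set.mem_univ _)
  filter_upwards [h1, h2, ae_uniformCube_of_ae (ae_genericVector n)] with x h1 h2 h3
  have hinj := h3.injective
  have hmem : x ∘ Tuple.sort x ∈ orderedCube n :=
    ⟨fun i => h2 _, (Tuple.monotone_sort x).strictMono_of_injective
      (hinj.comp (Tuple.sort x).injective)⟩
  -- With distinct coordinates exactly one permutation sorts `x`, so a single term of the sum
  -- survives.
  rw [Finset.sum_eq_single (Tuple.sort x), Set.indicator_of_mem hmem, ← h1 _ hmem,
    grenanderJumps_comp_perm]
  · intro σ _ hσ
    refine Set.indicator_of_notMem (fun hm => hσ ?_) _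
    have := Tuple.unique_monotone hm.2.monotone hmem.2.monotone
    ext i
    exact congrArg _ (hinj (congrFun this i))
  · simp

lemma measurable_indicator_orderedVertices {E : Type*} [Zero E] [MeasurableSpace E] (hn : 0 < n)
    (f : ℕ → E) :
    Measurable ((orderedCube n).indicator (fun x => f (orderedVertices n x))) :=
  ((measurable_from_nat (f := f)).comp (measurable_orderedVertices n)).indicator
    (measurableSet_orderedCube hn)

/-- Measurability is not visible from a count of discontinuities; it comes from the sum over
orderings, whose terms are measurable. -/
lemma aemeasurable_grenanderJumps (hn : 0 < n) :
    AEMeasurable (grenanderJumps (n := n)) (uniformCube n) := by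
  refine ⟨_, ?_, ae_comp_grenanderJumps hn id⟩
  refine Finset.measurable_sum _ fun σ _ => ?_
  exact (measurable_indicator_orderedVertices hn id).comp
    (measurePreserving_uniformCube σ).measurable

lemma MeasureTheory.MeasurePreserving.integral_comp_of_measurable {α : Type*} [MeasurableSpace α]
    {μ : Measure α} {f : α → α} (hf : MeasurePreserving f μ μ) {g : α → ℂ} (hg : Measurable g) :
    ∫ x, g (f x) ∂μ = ∫ x, g x ∂μ := by
  conv_rhs => rw [← hf.map_eq]
  rw [integral_map hf.measurable.aemeasurable hg.aestronglyMeasurable]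

/-- The `n!` orderings contribute equally, and the volume-preserving passage to spacings turns the
ordered cube into the simplex. -/
lemma integral_grenanderJumps_eq (hn : 0 < n) (f : ℕ → ℂ) (hf : ∀ k, ‖f k‖ ≤ 1) :
    ∫ x, f (grenanderJumps x) ∂uniformCube n =
      (n.factorial : ℂ) * ∫ y in spacings n, f (numVertices (List.ofFn y)) := by
  have hmeas := measurable_indicator_orderedVertices hn f
  rw [integral_congr_ae (ae_comp_grenanderJumps hn f), integral_finsetSum]
  · have h1 : ∀ σ : Equiv.Perm (Fin n), ∫ x, (orderedCube n).indicator
        (fun x => f (orderedVertices n x)) (x ∘ σ) ∂uniformCube n =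
        ∫ y in spacings n, f (numVertices (List.ofFn y)) := by
      intro σ
      rw [(measurePreserving_uniformCube σ).integral_comp_of_measurable hmeas,
        integral_indicator (measurableSet_orderedCube hn), uniformCube_eq,
        Measure.restrict_restrict (measurableSet_orderedCube hn)]
      have : orderedCube n ∩ Set.univ.pi (fun _ => Set.Ioo (0 : ℝ) 1) = orderedCube n :=
        Set.inter_eq_left.2 fun x hx i _ => hx.1 i
      rw [this, orderedCube_eq_preimage hn]
      exact ((measurePreserving_partialSums n).symm (partialSums n)).setIntegral_preimage_emb
        (partialSums n).symm.measurableEmbedding (fun y => f (numVertices (List.ofFn y))) _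
    rw [Finset.sum_congr rfl fun σ _ => h1 σ]
    simp [Fintype.card_perm]
  · intro σ _
    refine Integrable.of_bound (C := 1) (hmeas.comp
      (measurePreserving_uniformCube σ).measurable).aestronglyMeasurable (ae_of_all _ fun x => ?_)
    exact (norm_indicator_le_norm_self _ _).trans (hf _)

lemma volume_spacings_ne_top (n : ℕ) : volume (spacings n) ≠ ⊤ := by
  have hsub : spacings n ⊆ Set.univ.pi fun _ => Set.Ioo (0 : ℝ) 1 := fun y hy i _ =>
    ⟨hy.1 i, (Finset.single_le_sum (f := y) (fun j _ => (hy.1 j).le) (mem_univ i)).trans_lt hy.2⟩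
  refine ne_top_of_le_ne_top ?_ (measure_mono hsub)
  rw [Real.volume_pi_Ioo]
  simp

/-- The simplex is invariant under permuting the spacings, so the integrand may be summed over all
permutations; that sum is almost everywhere constant. -/
lemma factorial_mul_integral_spacings (n : ℕ) {z : ℂ} (hz : ‖z‖ ≤ 1) :
    (n.factorial : ℂ) * ∫ y in spacings n, z ^ numVertices (List.ofFn y) =
      (∏ k ∈ range n, (z + k)) * (volume.real (spacings n) : ℂ) := by
  have hms := measurableSet_spacings n
  have hmeas : Measurable fun y : Fin n → ℝ => z ^ numVertices (List.ofFn y) :=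
    (measurable_from_nat (f := fun k => z ^ k)).comp (measurable_numVertices_ofFn n)
  have hperm : ∀ σ : Equiv.Perm (Fin n),
      MeasurePreserving (fun y : Fin n → ℝ => y ∘ σ) volume volume :=
    fun σ => measurePreserving_comp_perm volume σ
  have h1 : ∀ σ : Equiv.Perm (Fin n), ∫ y in spacings n, z ^ numVertices (List.ofFn (y ∘ σ)) =
      ∫ y in spacings n, z ^ numVertices (List.ofFn y) := by
    intro σ
    rw [← integral_indicator hms, ← integral_indicator hms,
      ← (hperm σ).integral_comp_of_measurable (hmeas.indicator hms)]
    congr 1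
    funext y
    have : y ∘ σ ∈ spacings n ↔ y ∈ spacings n := by
      unfold spacings
      simp only [Set.mem_ofPred_eq, Function.comp_apply]
      rw [Equiv.sum_comp σ y]
      exact and_congr_left fun _ => σ.forall_congr_right (q := fun i => 0 < y i)
    by_cases hy : y ∈ spacings n
    · rw [Set.indicator_of_mem hy, Set.indicator_of_mem (this.2 hy)]
    · rw [Set.indicator_of_notMem hy, Set.indicator_of_notMem (mt this.1 hy)]
  have : IsFiniteMeasure (volume.restrict (spacings n)) :=
    ⟨by simpa using (volume_spacings_ne_top n).lt_top⟩
  calc (n.factorial : ℂ) * ∫ y in spacings n, z ^ numVertices (List.ofFn y)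
      = ∑ σ : Equiv.Perm (Fin n), ∫ y in spacings n, z ^ numVertices (List.ofFn (y ∘ σ)) := by
        rw [Finset.sum_congr rfl fun σ _ => h1 σ]
        simp [Fintype.card_perm]
    _ = ∫ y in spacings n, ∑ σ : Equiv.Perm (Fin n), z ^ numVertices (List.ofFn (y ∘ σ)) := by
        rw [integral_finsetSum]
        intro σ _
        refine Integrable.of_bound (C := 1)
          (hmeas.comp (hperm σ).measurable).aestronglyMeasurable (ae_of_all _ fun y => ?_)
        rw [norm_pow]
        exact pow_le_one₀ (norm_nonneg _) hz
    _ = ∫ y in spacings n, ∏ k ∈ range n, (z + k) :=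
        integral_congr_ae (ae_restrict_of_ae
          ((ae_genericVector n).mono fun y hy => hy.sum_perm z))
    _ = _ := by
        rw [setIntegral_const, Complex.real_smul, mul_comm]

/-- The generating function of the number of jumps of the Grenander estimator. -/
theorem integral_pow_grenanderJumps (hn : 0 < n) {z : ℂ} (hz : ‖z‖ ≤ 1) :
    ∫ x, z ^ grenanderJumps x ∂uniformCube n = ∏ k ∈ range n, (1 + (z - 1) / ((k : ℂ) + 1)) := by
  have main : ∀ z : ℂ, ‖z‖ ≤ 1 → ∫ x, z ^ grenanderJumps x ∂uniformCube n =
      (∏ k ∈ range n, (z + k)) * (volume.real (spacings n) : ℂ) := fun z hz => by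
    rw [integral_grenanderJumps_eq hn (fun k => z ^ k), factorial_mul_integral_spacings n hz]
    intro k
    rw [norm_pow]
    exact pow_le_one₀ (norm_nonneg _) hz
  -- At `z = 1` the integral is 1, which yields the volume of the simplex without computing it.
  have h1 := main 1 (by simp)
  simp only [one_pow, integral_const, probReal_univ, one_smul] at h1
  have hk : ∀ k : ℕ, (k : ℂ) + 1 ≠ 0 := fun k => by exact_mod_cast k.succ_ne_zero
  have h2 : ∏ k ∈ range n, (1 + (z - 1) / ((k : ℂ) + 1)) =
      (∏ k ∈ range n, (z + k)) / ∏ k ∈ range n, (1 + (k : ℂ)) := by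
    rw [← Finset.prod_div_distrib]
    refine Finset.prod_congr rfl fun k _ => ?_
    have := hk k
    have : 1 + (k : ℂ) ≠ 0 := by rwa [add_comm]
    field_simp
    ring
  have h3 : ∏ k ∈ range n, (1 + (k : ℂ)) ≠ 0 :=
    Finset.prod_ne_zero_iff.2 fun k _ => by rw [add_comm]; exact hk k
  rw [main z hz, h2, eq_div_iff h3, mul_assoc, mul_comm (volume.real (spacings n) : ℂ), ← h1,
    mul_one]

end Law

/-! ### Poisson approximation and the limit of the characteristic functions. -/

lemma norm_prod_range_sub_prod_range_le {a b : ℕ → ℂ} (ha : ∀ k, ‖a k‖ ≤ 1) (hb : ∀ k, ‖b k‖ ≤ 1)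
    (n : ℕ) : ‖∏ k ∈ range n, a k - ∏ k ∈ range n, b k‖ ≤ ∑ k ∈ range n, ‖a k - b k‖ := by
  induction n with
  | zero => simp
  | succ n ih =>
    rw [prod_range_succ, prod_range_succ, sum_range_succ]
    have hB : ‖∏ k ∈ range n, b k‖ ≤ 1 := by
      rw [norm_prod]
      exact prod_le_one (fun _ _ => norm_nonneg _) fun k _ => hb k
    have e : (∏ k ∈ range n, a k) * a n - (∏ k ∈ range n, b k) * b n =
        (∏ k ∈ range n, a k - ∏ k ∈ range n, b k) * a n + (∏ k ∈ range n, b k) * (a n - b n) := by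
      ring
    rw [e]
    refine (norm_add_le _ _).trans (add_le_add ?_ ?_)
    · rw [norm_mul]
      exact (mul_le_of_le_one_right (norm_nonneg _) (ha n)).trans ih
    · rw [norm_mul]
      exact mul_le_of_le_one_left (norm_nonneg _) hB

lemma exists_sum_inv_sq_le :
    ∃ C : ℝ, ∀ n : ℕ, ∑ k ∈ range n, 1 / ((k : ℝ) + 1) ^ 2 ≤ C := by
  have h := (summable_nat_add_iff 1).2 (Real.summable_one_div_nat_pow.2 one_lt_two)
  refine ⟨∑' k : ℕ, 1 / ((k + 1 : ℕ) : ℝ) ^ 2, fun n => ?_⟩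
  have := h.sum_le_tsum (range n) fun k _ => by positivity
  simpa using this

/-- Factor by factor, `1 + w / (k + 1)` and `exp (w / (k + 1))` lie in the unit disc and differ by
at most `(‖w‖ / (k + 1))²`, which is summable in `k`. -/
lemma exists_norm_prod_sub_exp_le :
    ∃ C : ℝ, ∀ (n : ℕ) (s : ℝ), ‖Complex.exp (s * Complex.I) - 1‖ ≤ 1 →
      ‖∏ k ∈ range n, (1 + (Complex.exp (s * Complex.I) - 1) / ((k : ℂ) + 1)) -
        Complex.exp ((Complex.exp (s * Complex.I) - 1) * (harmonic n : ℂ))‖ ≤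
        C * ‖Complex.exp (s * Complex.I) - 1‖ ^ 2 := by
  obtain ⟨C, hC⟩ := exists_sum_inv_sq_le
  refine ⟨C, fun n s hs => ?_⟩
  set w := Complex.exp (s * Complex.I) - 1 with hw
  have hw1 : ‖w + 1‖ = 1 := by rw [hw, sub_add_cancel, Complex.norm_exp_ofReal_mul_I]
  have hwre : w.re ≤ 0 := by
    have := Complex.re_le_norm (w + 1)
    rw [hw1, Complex.add_re, Complex.one_re] at this
    linarith
  have hnorm : ∀ k : ℕ, ‖w / ((k : ℂ) + 1)‖ = ‖w‖ / ((k : ℝ) + 1) := by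
    intro k
    rw [norm_div]
    congr 1
    exact_mod_cast Complex.norm_natCast (k + 1)
  have hexp : Complex.exp (w * (harmonic n : ℂ)) =
      ∏ k ∈ range n, Complex.exp (w / ((k : ℂ) + 1)) := by
    rw [← Complex.exp_sum, harmonic, Rat.cast_sum, Finset.mul_sum]
    congr 1
    refine Finset.sum_congr rfl fun k _ => ?_
    push_cast
    rw [div_eq_mul_inv]
  rw [hexp]
  refine (norm_prod_range_sub_prod_range_le ?_ ?_ n).trans ?_
  · intro k
    have hk : (0 : ℝ) < (k : ℝ) + 1 := by positivity
    have hkc : ((k : ℂ) + 1) ≠ 0 := by exact_mod_cast k.succ_ne_zero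
    -- The factor is a convex combination of 1 and a point of the unit circle.
    have e : 1 + w / ((k : ℂ) + 1) = ((k : ℂ) + (w + 1)) / ((k : ℂ) + 1) := by
      field_simp
      ring
    have hk1 : ‖(k : ℂ) + 1‖ = (k : ℝ) + 1 := by exact_mod_cast Complex.norm_natCast (k + 1)
    rw [e, norm_div, hk1, div_le_one hk]
    refine (norm_add_le _ _).trans ?_
    rw [hw1, Complex.norm_natCast]
  · intro k
    rw [Complex.norm_exp, Real.exp_le_one_iff]
    have e : w / ((k : ℂ) + 1) = w / (((k : ℝ) + 1 : ℝ) : ℂ) := by push_cast; rfl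
    rw [e, Complex.div_ofReal_re]
    exact div_nonpos_of_nonpos_of_nonneg hwre (by positivity)
  · calc ∑ k ∈ range n, ‖1 + w / ((k : ℂ) + 1) - Complex.exp (w / ((k : ℂ) + 1))‖
        ≤ ∑ k ∈ range n, 1 / ((k : ℝ) + 1) ^ 2 * ‖w‖ ^ 2 := by
          refine Finset.sum_le_sum fun k _ => ?_
          have hle : ‖w / ((k : ℂ) + 1)‖ ≤ 1 := by
            rw [hnorm]
            refine (div_le_self (norm_nonneg _) ?_).trans hs
            linarith [k.cast_nonneg (α := ℝ)]
          have := Complex.norm_exp_sub_one_sub_id_le hle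
          rw [← norm_neg] at this
          calc _ = ‖-(Complex.exp (w / ((k : ℂ) + 1)) - 1 - w / ((k : ℂ) + 1))‖ := by
                congr 1; ring
            _ ≤ ‖w / ((k : ℂ) + 1)‖ ^ 2 := this
            _ = _ := by rw [hnorm, div_pow]; ring
      _ ≤ C * ‖w‖ ^ 2 := by
          rw [← Finset.sum_mul]
          exact mul_le_mul_of_nonneg_right (hC n) (by positivity)

lemma tendsto_div_sqrt_log (t : ℝ) :
    Tendsto (fun n : ℕ => t / √(Real.log n)) atTop (𝓝 0) :=
  tendsto_const_nhds.div_atTop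
    (Real.tendsto_sqrt_atTop.comp (Real.tendsto_log_atTop.comp tendsto_natCast_atTop_atTop))

lemma tendsto_exp_sub_one (t : ℝ) : Tendsto
    (fun n : ℕ => Complex.exp ((t / √(Real.log n) : ℝ) * Complex.I) - 1) atTop (𝓝 0) := by
  have h : Continuous fun s : ℝ => Complex.exp (s * Complex.I) - 1 := by fun_prop
  have := (h.tendsto 0).comp (tendsto_div_sqrt_log t)
  simpa [Function.comp_def] using this

lemma eventually_sq_mul_log (t : ℝ) :
    ∀ᶠ n : ℕ in atTop, (t / √(Real.log n)) ^ 2 * Real.log n = t ^ 2 := by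
  filter_upwards [(Real.tendsto_log_atTop.comp tendsto_natCast_atTop_atTop).eventually_gt_atTop 0]
    with n hn
  simp only [Function.comp_apply] at hn
  rw [div_pow, Real.sq_sqrt hn.le]
  field_simp

/-- With `w = exp (i s) - 1`, the exponent is `(w - i s + s² / 2) log n + w (H_n - log n) - s² log n
/ 2`. The first term is at most `|s| t²`, the second tends to 0 times Euler's constant, and `s² log
n` is eventually `t²`. -/
lemma tendsto_exponent (t : ℝ) : Tendsto
    (fun n : ℕ => (Complex.exp ((t / √(Real.log n) : ℝ) * Complex.I) - 1) * (harmonic n : ℂ) -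
      (t / √(Real.log n) : ℝ) * (Real.log n : ℂ) * Complex.I) atTop
    (𝓝 (-(t : ℂ) ^ 2 / 2)) := by
  set s : ℕ → ℝ := fun n => t / √(Real.log n) with hs
  have hs0 : Tendsto s atTop (𝓝 0) := tendsto_div_sqrt_log t
  have hsq := eventually_sq_mul_log t
  have hw := tendsto_exp_sub_one t
  have hH : Tendsto (fun n : ℕ => (harmonic n : ℂ) - (Real.log n : ℂ)) atTop
      (𝓝 (Real.eulerMascheroniConstant : ℂ)) := by
    have := (Complex.continuous_ofReal.tendsto _).comp Real.tendsto_harmonic_sub_log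
    refine this.congr fun n => ?_
    simp
  have h1 : Tendsto (fun n : ℕ => (Complex.exp (s n * Complex.I) - 1 - s n * Complex.I +
      (s n : ℂ) ^ 2 / 2) * (Real.log n : ℂ)) atTop (𝓝 0) := by
    rw [tendsto_zero_iff_norm_tendsto_zero]
    have hbound : Tendsto (fun n => |s n| * t ^ 2) atTop (𝓝 0) := by
      simpa using (hs0.abs).mul_const (t ^ 2)
    refine squeeze_zero' (Eventually.of_forall fun n => norm_nonneg _) ?_ hbound
    have hs1 : ∀ᶠ n in atTop, |s n| < 1 := by
      have := hs0.abs
      rw [abs_zero] at this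
      exact this.eventually_lt_const one_pos
    filter_upwards [hs1, hsq] with n hn1 hn2
    have hx : ‖(s n : ℂ) * Complex.I‖ = |s n| := by simp
    have hb := Complex.exp_bound (x := (s n : ℂ) * Complex.I) (by rw [hx]; exact hn1.le)
      (n := 3) (by norm_num)
    have e : ∑ m ∈ range 3, ((s n : ℂ) * Complex.I) ^ m / (m.factorial : ℂ) =
        1 + s n * Complex.I - (s n : ℂ) ^ 2 / 2 := by
      simp [Finset.sum_range_succ, mul_pow]
      ring
    rw [e, hx] at hb
    have hlog : 0 ≤ Real.log n := Real.log_natCast_nonneg n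
    have hb' : ‖Complex.exp (s n * Complex.I) - 1 - s n * Complex.I + (s n : ℂ) ^ 2 / 2‖ ≤
        |s n| ^ 3 := by
      calc _ = ‖Complex.exp (s n * Complex.I) -
            (1 + s n * Complex.I - (s n : ℂ) ^ 2 / 2)‖ := by congr 1; ring
        _ ≤ _ := hb
        _ ≤ |s n| ^ 3 := by
            refine mul_le_of_le_one_right (by positivity) ?_
            norm_num [Nat.factorial]
    rw [norm_mul, Complex.norm_real, Real.norm_of_nonneg hlog]
    calc _ ≤ |s n| ^ 3 * Real.log n := mul_le_mul_of_nonneg_right hb' hlog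
      _ = |s n| * ((s n) ^ 2 * Real.log n) := by rw [← sq_abs (s n)]; ring
      _ = _ := by rw [hn2]
  have h2 := hw.mul hH
  rw [zero_mul] at h2
  have h3 := (h1.add h2).add_const (-(t : ℂ) ^ 2 / 2)
  rw [add_zero, zero_add] at h3
  refine h3.congr' ?_
  filter_upwards [hsq] with n hn
  have hn' : (s n : ℂ) ^ 2 * (Real.log n : ℂ) = (t : ℂ) ^ 2 := by exact_mod_cast hn
  linear_combination (1 / 2 : ℂ) * hn'

/-- The centring factor has modulus 1, so it does not enlarge the Poisson error, which vanishes with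
`‖w‖²`. -/
lemma tendsto_charFun_prod (t : ℝ) : Tendsto
    (fun n : ℕ => Complex.exp (-((t / √(Real.log n) : ℝ) * (Real.log n : ℂ) * Complex.I)) *
      ∏ k ∈ range n, (1 + (Complex.exp ((t / √(Real.log n) : ℝ) * Complex.I) - 1) /
        ((k : ℂ) + 1))) atTop (𝓝 (Complex.exp (-(t : ℂ) ^ 2 / 2))) := by
  obtain ⟨C, hC⟩ := exists_norm_prod_sub_exp_le
  have hw := tendsto_exp_sub_one t
  have h1 := (Complex.continuous_exp.tendsto _).comp (tendsto_exponent t)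
  refine h1.congr_dist ?_
  have hb := (hw.norm.pow 2).const_mul C
  simp only [norm_zero, ne_eq, OfNat.ofNat_ne_zero, not_false_eq_true, zero_pow, mul_zero] at hb
  refine squeeze_zero' (Eventually.of_forall fun n => dist_nonneg) ?_ hb
  have hw1 := hw.norm
  rw [norm_zero] at hw1
  filter_upwards [hw1.eventually_le_const one_pos] with n hn
  refine le_trans (le_of_eq ?_) (hC n _ hn)
  have : ‖Complex.exp (-((t / √(Real.log n) : ℝ) * (Real.log n : ℂ) * Complex.I))‖ = 1 := by
    rw [← neg_mul]
    exact_mod_cast Complex.norm_exp_ofReal_mul_I (-(t / √(Real.log n) * Real.log n))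
  rw [dist_comm, dist_eq_norm, Function.comp_apply, sub_eq_neg_add _ (_ * _ * _), Complex.exp_add,
    ← mul_sub, norm_mul, this, one_mul]

/-! ### Transfer to an arbitrary uniform sample, and the limit theorem. -/

section Sample

variable {Ω : Type*} [MeasurableSpace Ω] {P : Measure Ω} {n : ℕ}
  {X : Fin n → Ω → ℝ}

lemma aemeasurable_of_isUniform (hunif : ∀ i, pdf.IsUniform (X i) (Set.Ioo (0 : ℝ) 1) P)
    (i : Fin n) :
    AEMeasurable (X i) P :=
  (hunif i).aemeasurable (by simp) (by simp)

variable [IsProbabilityMeasure P]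

lemma map_sample_eq_uniformCube (hindep : iIndepFun X P)
    (hunif : ∀ i, pdf.IsUniform (X i) (Set.Ioo (0 : ℝ) 1) P) :
    P.map (fun ω i => X i ω) = uniformCube n := by
  rw [(iIndepFun_iff_map_fun_eq_pi_map (aemeasurable_of_isUniform hunif)).1 hindep, uniformCube]
  congr 1
  funext i
  rw [hunif i, ProbabilityTheory.cond]
  simp

lemma aemeasurable_jumps_sample (hindep : iIndepFun X P)
    (hunif : ∀ i, pdf.IsUniform (X i) (Set.Ioo (0 : ℝ) 1) P) :
    AEMeasurable (fun ω => grenanderJumps fun i => X i ω) P := by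
  rcases Nat.eq_zero_or_pos n with rfl | hn
  · have : (fun ω => grenanderJumps fun i => X i ω) = fun _ => grenanderJumps finZeroElim := by
      funext ω
      congr 1
      exact Subsingleton.elim _ _
    rw [this]
    exact aemeasurable_const
  · have h := aemeasurable_grenanderJumps hn
    rw [← map_sample_eq_uniformCube hindep hunif] at h
    exact h.comp_aemeasurable (aemeasurable_pi_lambda _ (aemeasurable_of_isUniform hunif))

lemma integral_pow_jumps_sample (hn : 0 < n) (hindep : iIndepFun X P)
    (hunif : ∀ i, pdf.IsUniform (X i) (Set.Ioo (0 : ℝ) 1) P) {z : ℂ} (hz : ‖z‖ ≤ 1) :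
    ∫ ω, z ^ grenanderJumps (fun i => X i ω) ∂P =
      ∏ k ∈ range n, (1 + (z - 1) / ((k : ℂ) + 1)) := by
  rw [← integral_pow_grenanderJumps hn hz, ← map_sample_eq_uniformCube hindep hunif, integral_map]
  · exact aemeasurable_pi_lambda _ (aemeasurable_of_isUniform hunif)
  · rw [map_sample_eq_uniformCube hindep hunif]
    exact ((measurable_from_nat (f := fun k => z ^ k)).comp_aemeasurable
      (aemeasurable_grenanderJumps hn)).aestronglyMeasurable

end Sample

theorem mainTheorem6 {Ω : ℕ → Type*} [∀ n, MeasurableSpace (Ω n)]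
    (P : ∀ n, MeasureTheory.Measure (Ω n)) [∀ n, MeasureTheory.IsProbabilityMeasure (P n)]
    (X : ∀ n, Fin n → Ω n → ℝ)
    (hindep : ∀ n, ProbabilityTheory.iIndepFun (X n) (P n))
    (hunif : ∀ n i, MeasureTheory.pdf.IsUniform (X n i) (Set.Ioo (0 : ℝ) 1) (P n)) :
    MeasureTheory.TendstoInDistribution
      (fun (n : ℕ) (ω : Ω n) =>
        ((grenanderJumps (fun i => X n i ω) : ℝ) - Real.log n) / Real.sqrt (Real.log n))
      Filter.atTop (id : ℝ → ℝ) P (ProbabilityTheory.gaussianReal 0 1) := by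
  have hmeas : ∀ n : ℕ, AEMeasurable (fun ω : Ω n =>
      ((grenanderJumps (fun i => X n i ω) : ℝ) - Real.log n) / Real.sqrt (Real.log n)) (P n) := by
    intro n
    have h : AEMeasurable (fun ω : Ω n => (grenanderJumps (fun i => X n i ω) : ℝ)) (P n) :=
      (measurable_from_nat (f := fun k : ℕ => (k : ℝ))).comp_aemeasurable
        (aemeasurable_jumps_sample (hindep n) (hunif n))
    exact (h.sub_const _).div_const _
  refine ⟨hmeas, aemeasurable_id, ProbabilityMeasure.tendsto_of_tendsto_charFun fun t => ?_⟩
  simp only [ProbabilityMeasure.coe_mk, Measure.map_id, charFun_gaussianReal]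
  have hlim := tendsto_charFun_prod t
  have hend : (t : ℂ) * ((0 : ℝ) : ℂ) * Complex.I - (((1 : NNReal) : ℝ) : ℂ) * (t : ℂ) ^ 2 / 2 =
      -(t : ℂ) ^ 2 / 2 := by
    push_cast
    ring
  rw [hend]
  refine hlim.congr' ?_
  -- The product formula needs a nonempty sample; it is applied with `z = exp (i t / √(log n))`.
  filter_upwards [eventually_gt_atTop 0] with n hn
  rw [charFun_apply_real, integral_map (hmeas n) (by fun_prop),
    ← integral_pow_jumps_sample hn (hindep n) (hunif n) (Complex.norm_exp_ofReal_mul_I _).le,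
    ← integral_const_mul]
  congr 1
  funext ω
  rw [← Complex.exp_nat_mul, ← Complex.exp_add]
  congr 1
  push_cast
  ring
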